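/- A modal algebra is a Boolean algebra $B$ with an operator $\Diamond:B\to B$ such that $\Diamond(a\vee b)=\Diamond a\vee\Diamond b$ and $\Diamond\bot=\bot$; with Boolean homomorphisms commuting with $\Diamond$ they form the category $\mathbf{MA}$. A variety of modal algebras is a class $V$ of modal algebras defined by a set of equations; it is finitely approximable if it is generated by its finite members, i.e. every variety containing all finite members of $V$ contains $V$. Let $V_f$ be the full subcategory of $\mathbf{MA}$ on the finite algebras in $V$, with inclusion $\iota_f:V_f\hookrightarrow\mathbf{MA}$, and let $\mathrm{Pro}\,V_f=(\mathrm{Ind}(V_f^{op}))^{op}$ be its pro-completion, where $\mathrm{Ind}(\mathcal C)$ is the category of presheaves on $\mathcal C$ that are small filtered colimits of representables. Let $\iota:\mathrm{Pro}\,V_f\to\mathbf{MA}$ be the functor sending a formal cofiltered limit of finite algebras to their limit in $\mathbf{MA}$ (so $\iota$ restricts to $\iota_f$ on $V_f$), and let $U:\mathrm{Pro}\,V_f\to\mathbf{Set}$ be the forgetful functor, i.e. $\iota$ followed by the underlying-set functor of $\mathbf{MA}$. **Theorem.** Let $V$ be a finitely approximable variety of modal algebras. (1) The forgetful functor $U:\mathrm{Pro}\,V_f\to\mathbf{Set}$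 is monadic: it has a left adjoint, and the comparison functor to the Eilenberg–Moore category of the induced monad is an equivalence. (2) Let $L$ be any left adjoint of $U$, let $X$ be a set, and let $e_X:X\to F_V(X)$ be the free $V$-algebra on $X$. Let $\pi:F_V(X)\downarrow\iota_f\to V_f\hookrightarrow\mathrm{Pro}\,V_f$ be the functor sending a homomorphism $F_V(X)\to\iota_f(C)$ to $C$. Then $\varprojlim\pi$ exists in $\mathrm{Pro}\,V_f$, it is preserved by $\iota$ (so that $\iota(\varprojlim\pi)\cong\varprojlim\iota\pi$ in $\mathbf{MA}$), and there is an isomorphism $L(X)\cong\varprojlim\pi$ under which the unit $X\to U(L(X))$ of the adjunction is the composite $$X\xrightarrow{\;e_X\;}F_V(X)\xrightarrow{\;\eta\;}\iota(\varprojlim\pi)\cong\varprojlim\iota\pi ,$$ where $\eta$ is the homomorphism induced by the universal property of the limit from the cone whose component at an object $h:F_V(X)\to\iota_f(C)$ is $h$ itself. -/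

import Mathlib

open CategoryTheory Limits Opposite

universe w u

/-! ### Modal algebras -/

/-- A modal algebra: a Boolean algebra with an operator `◇` preserving finite joins. -/
class ModalAlgebra (B : Type u) extends BooleanAlgebra B where
  dia : B → B
  dia_sup : ∀ a b : B, dia (a ⊔ b) = dia a ⊔ dia b
  dia_bot : dia ⊥ = ⊥

/-- A morphism of modal algebras: a Boolean homomorphism (equivalently, a bounded lattice
homomorphism between Boolean algebras) commuting with `◇`. -/
structure ModalHom (A B : Type*) [ModalAlgebra A] [ModalAlgebra B]
    extends BoundedLatticeHom A B where
  map_dia' : ∀ a : A, toFun (ModalAlgebra.dia a) = ModalAlgebra.dia (toFun a)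

namespace ModalHom

variable {A B C : Type*} [ModalAlgebra A] [ModalAlgebra B] [ModalAlgebra C]

instance : FunLike (ModalHom A B) A B where
  coe f := f.toFun
  coe_injective f g h := by
    obtain ⟨⟨⟨⟨f, _⟩, _⟩, _, _⟩, _⟩ := f
    obtain ⟨⟨⟨⟨g, _⟩, _⟩, _, _⟩, _⟩ := g
    congr

instance : BoundedLatticeHomClass (ModalHom A B) A B where
  map_sup f := f.map_sup'
  map_inf f := f.map_inf'
  map_top f := f.map_top'
  map_bot f := f.map_bot'

theorem map_dia (f : ModalHom A B) (a : A) :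
    f (ModalAlgebra.dia a) = ModalAlgebra.dia (f a) := f.map_dia' a

@[ext]
theorem ext {f g : ModalHom A B} (h : ∀ a, f a = g a) : f = g := DFunLike.ext f g h

/-- The identity morphism. -/
def id (A : Type*) [ModalAlgebra A] : ModalHom A A :=
  { BoundedLatticeHom.id A with map_dia' := fun _ => rfl }

/-- Composition of morphisms. -/
def comp (g : ModalHom B C) (f : ModalHom A B) : ModalHom A C :=
  { g.toBoundedLatticeHom.comp f.toBoundedLatticeHom with
    map_dia' := fun a => (congrArg g (f.map_dia a)).trans (g.map_dia (f a)) }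

/-- A map preserving `⊥`, `⊔`, complements and `◇` is a morphism of modal algebras. -/
def ofPreserves (f : A → B) (hbot : f ⊥ = ⊥) (hsup : ∀ a b, f (a ⊔ b) = f a ⊔ f b)
    (hcompl : ∀ a, f aᶜ = (f a)ᶜ)
    (hdia : ∀ a, f (ModalAlgebra.dia a) = ModalAlgebra.dia (f a)) : ModalHom A B where
  toFun := f
  map_sup' := hsup
  map_inf' a b := by
    rw [← compl_compl (a ⊓ b), compl_inf, hcompl, hsup, hcompl, hcompl, compl_sup, compl_compl,
      compl_compl]
  map_top' := by rw [← compl_bot, hcompl, hbot, compl_bot]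
  map_bot' := hbot
  map_dia' := hdia

/-- The inverse of a bijective morphism. -/
def symm (f : ModalHom A B) (e : A ≃ B) (h : ∀ a, f a = e a) : ModalHom B A :=
  ofPreserves e.symm
    (by rw [Equiv.symm_apply_eq, ← h, map_bot])
    (fun a b => by rw [Equiv.symm_apply_eq, ← h, map_sup, h, h]; simp)
    (fun a => by rw [Equiv.symm_apply_eq, ← h, map_compl', h]; simp)
    (fun a => by rw [Equiv.symm_apply_eq, ← h, f.map_dia, h]; simp)

end ModalHom

/-- The category `MA` of modal algebras (with carrier in `Type u`). -/
structure ModAlg where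
  of ::
  carrier : Type u
  [str : ModalAlgebra carrier]

attribute [instance] ModAlg.str

namespace ModAlg

instance : CoeSort ModAlg.{u} (Type u) := ⟨ModAlg.carrier⟩

/-- The type of morphisms of `ModAlg`. -/
@[ext]
structure Hom (A B : ModAlg.{u}) where
  hom' : ModalHom A B

instance : Category ModAlg.{u} where
  Hom A B := Hom A B
  id A := ⟨ModalHom.id A⟩
  comp f g := ⟨g.hom'.comp f.hom'⟩

instance : ConcreteCategory ModAlg.{u} (fun A B => ModalHom A B) where
  hom := Hom.hom'
  ofHom := Hom.mk

/-- An isomorphism of modal algebras from a bijective morphism. -/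
def isoMk {A B : ModAlg.{u}} (f : ModalHom A B) (e : A ≃ B) (h : ∀ a, f a = e a) : A ≅ B where
  hom := ⟨f⟩
  inv := ⟨f.symm e h⟩
  hom_inv_id := Hom.ext (ModalHom.ext fun a => (congrArg e.symm (h a)).trans (e.symm_apply_apply a))
  inv_hom_id := Hom.ext (ModalHom.ext fun b => (h (e.symm b)).trans (e.apply_symm_apply b))

end ModAlg

/-! ### Auxiliary constructions of modal algebras -/

/-- Pull back a modal algebra structure along an injective map commuting with the operations. -/
abbrev ModalAlgebra.ofInjective {α : Type*} {β : Type*} [ModalAlgebra β]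
    (bot : α) (sup : α → α → α) (compl : α → α) (dia : α → α)
    (f : α → β) (hf : Function.Injective f) (hbot : f bot = ⊥)
    (hsup : ∀ a b, f (sup a b) = f a ⊔ f b) (hcompl : ∀ a, f (compl a) = (f a)ᶜ)
    (hdia : ∀ a, f (dia a) = ModalAlgebra.dia (f a)) : ModalAlgebra α :=
  letI : Max α := ⟨sup⟩
  letI : Min α := ⟨fun a b => compl (sup (compl a) (compl b))⟩
  letI : LE α := ⟨fun a b => f a ≤ f b⟩
  letI : LT α := ⟨fun a b => f a < f b⟩
  letI : Top α := ⟨compl bot⟩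
  letI : Bot α := ⟨bot⟩
  letI : Compl α := ⟨compl⟩
  letI : SDiff α := ⟨fun a b => compl (sup (compl a) b)⟩
  letI : HImp α := ⟨fun a b => sup b (compl a)⟩
  { hf.booleanAlgebra f Iff.rfl Iff.rfl hsup
      (fun a b => (hcompl _).trans (by rw [hsup, hcompl, hcompl, compl_sup, compl_compl, compl_compl]))
      ((hcompl _).trans (by rw [hbot, compl_bot])) hbot hcompl
      (fun a b => (hcompl _).trans (by rw [hsup, hcompl, compl_sup, compl_compl, sdiff_eq]))
      (fun a b => (hsup _ _).trans (by rw [hcompl, himp_eq])) with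
    dia := dia
    dia_sup := fun a b => hf ((hdia _).trans (((congrArg _ (hsup a b)).trans
      (ModalAlgebra.dia_sup _ _)).trans (((hsup _ _).trans (by rw [hdia, hdia])).symm)))
    dia_bot := hf ((hdia _).trans (((congrArg _ hbot).trans ModalAlgebra.dia_bot).trans hbot.symm)) }

/-- Products of modal algebras, with pointwise operations. -/
instance Pi.modalAlgebra {ι : Type*} (B : ι → Type*) [∀ i, ModalAlgebra (B i)] :
    ModalAlgebra (∀ i, B i) where
  dia a i := ModalAlgebra.dia (a i)
  dia_sup _ _ := funext fun _ => ModalAlgebra.dia_sup _ _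
  dia_bot := funext fun _ => ModalAlgebra.dia_bot

/-- Transport of a modal algebra structure to a model of its carrier in a smaller universe. -/
noncomputable instance Shrink.modalAlgebra (B : Type*) [ModalAlgebra B] [Small.{w} B] :
    ModalAlgebra (Shrink.{w} B) :=
  ModalAlgebra.ofInjective (equivShrink B ⊥)
    (fun a b => equivShrink B ((equivShrink B).symm a ⊔ (equivShrink B).symm b))
    (fun a => equivShrink B ((equivShrink B).symm a)ᶜ)
    (fun a => equivShrink B (ModalAlgebra.dia ((equivShrink B).symm a)))
    (equivShrink B).symm (equivShrink B).symm.injective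
    (by simp) (by simp) (by simp) (by simp)

/-- The canonical isomorphism from a modal algebra to its small model, as a morphism. -/
noncomputable def equivShrinkHom (B : Type*) [ModalAlgebra B] [Small.{w} B] :
    ModalHom B (Shrink.{w} B) :=
  ModalHom.ofPreserves (equivShrink B) rfl
    (fun a b => by
      change _ = equivShrink B ((equivShrink B).symm _ ⊔ (equivShrink B).symm _)
      simp)
    (fun a => by
      change _ = equivShrink B ((equivShrink B).symm _)ᶜ
      simp)
    (fun a => by
      change _ = equivShrink B (ModalAlgebra.dia ((equivShrink B).symm _))
      simp)

/-! ### Terms, equations, varieties -/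

/-- Terms in the signature of modal algebras over a set `X` of variables
(`⊤` and `⊓` are definable from `⊥`, `⊔` and complement). -/
inductive ModalTerm (X : Type w) : Type w
  | var : X → ModalTerm X
  | bot : ModalTerm X
  | sup : ModalTerm X → ModalTerm X → ModalTerm X
  | compl : ModalTerm X → ModalTerm X
  | dia : ModalTerm X → ModalTerm X

namespace ModalTerm

/-- The value of a term in a modal algebra under an assignment of the variables. -/
def eval {X : Type w} {B : Type u} [ModalAlgebra B] (v : X → B) : ModalTerm X → B
  | var x => v x
  | bot => ⊥
  | sup s t => eval v s ⊔ eval v t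
  | compl s => (eval v s)ᶜ
  | dia s => ModalAlgebra.dia (eval v s)

/-- Simultaneous substitution of terms for variables. -/
def subst {X Y : Type*} (σ : X → ModalTerm Y) : ModalTerm X → ModalTerm Y
  | var x => σ x
  | bot => bot
  | sup s t => sup (subst σ s) (subst σ t)
  | compl s => compl (subst σ s)
  | dia s => dia (subst σ s)

theorem eval_subst {X Y : Type*} {B : Type*} [ModalAlgebra B] (σ : X → ModalTerm Y) (v : Y → B)
    (s : ModalTerm X) : eval v (subst σ s) = eval (fun x => eval v (σ x)) s := by
  induction s <;> simp_all [eval, subst]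

end ModalTerm

/-- A class of modal algebras is a variety if it is the class of models of a set of equations
(in countably many variables). -/
def IsVariety (V : ObjectProperty ModAlg.{u}) : Prop :=
  ∃ E : Set (ModalTerm ℕ × ModalTerm ℕ), ∀ A : ModAlg.{u},
    V A ↔ ∀ e ∈ E, ∀ v : ℕ → A, e.1.eval v = e.2.eval v

/-- The finite members of a class of modal algebras. -/
def finiteMembers (V : ObjectProperty ModAlg.{u}) : ObjectProperty ModAlg.{u} :=
  fun A => V A ∧ Finite A

/-- `V` is finitely approximable if it is generated by its finite members, that is, `V` is
contained in every variety that contains all the finite members of `V`. -/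
def FinitelyApproximable (V : ObjectProperty ModAlg.{u}) : Prop :=
  ∀ W : ObjectProperty ModAlg.{u}, IsVariety W → finiteMembers V ≤ W → V ≤ W

/-! ### Free algebras -/

/-- Two terms are identified if the corresponding equation holds throughout `V`. -/
def termSetoid (V : ObjectProperty ModAlg.{u}) (X : Type u) : Setoid (ModalTerm X) where
  r s t := ∀ A : ModAlg.{u}, V A → ∀ v : X → A, s.eval v = t.eval v
  iseqv :=
    { refl := fun _ _ _ _ => rfl
      symm := fun h A hA v => (h A hA v).symm
      trans := fun h k A hA v => (h A hA v).trans (k A hA v) }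

/-- The carrier of the free `V`-algebra on `X`. -/
def FreeCarrier (V : ObjectProperty ModAlg.{u}) (X : Type u) : Type u :=
  Quotient (termSetoid V X)

namespace FreeCarrier

variable (V : ObjectProperty ModAlg.{u}) (X : Type u)

/-- The class of a term. -/
def mk (s : ModalTerm X) : FreeCarrier V X := Quotient.mk (termSetoid V X) s

/-- Evaluation of classes of terms at all assignments in all members of `V`. -/
def evalAll (a : FreeCarrier V X) (p : Σ A : V.FullSubcategory, X → A.obj) : p.1.obj :=
  Quotient.lift (s := termSetoid V X) (fun s : ModalTerm X => s.eval p.2)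
    (fun s t (h : (termSetoid V X).r s t) => h p.1.obj p.1.property p.2) a

/-- The operations on classes of terms are induced by the term constructors. -/
instance : ModalAlgebra (FreeCarrier V X) :=
  ModalAlgebra.ofInjective (mk V X ModalTerm.bot)
    (Quotient.map₂ ModalTerm.sup fun _ _ h _ _ k A hA v =>
      congrArg₂ (· ⊔ ·) (h A hA v) (k A hA v))
    (Quotient.map ModalTerm.compl fun _ _ h A hA v => congrArg (·ᶜ) (h A hA v))
    (Quotient.map ModalTerm.dia fun _ _ h A hA v => congrArg ModalAlgebra.dia (h A hA v))
    (evalAll V X)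
    (by
      rintro ⟨a⟩ ⟨b⟩ h
      exact Quotient.sound fun A hA v => congrFun h ⟨⟨A, hA⟩, v⟩)
    rfl (by rintro ⟨a⟩ ⟨b⟩; rfl) (by rintro ⟨a⟩; rfl) (by rintro ⟨a⟩; rfl)

theorem eval_mk {V : ObjectProperty ModAlg.{u}} {X : Type u} {Y : Type*}
    (σ : Y → ModalTerm X) (s : ModalTerm Y) :
    s.eval (fun y => mk V X (σ y)) = mk V X (s.subst σ) := by
  induction s with
  | var y => rfl
  | bot => rfl
  | sup s t hs ht => simp only [ModalTerm.eval, hs, ht]; rfl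
  | compl s hs => simp only [ModalTerm.eval, hs]; rfl
  | dia s hs => simp only [ModalTerm.eval, hs]; rfl

end FreeCarrier

/-- The free `V`-algebra on `X`: terms over `X` modulo the equations valid in `V`. -/
def freeAlg (V : ObjectProperty ModAlg.{u}) (X : Type u) : ModAlg.{u} :=
  ModAlg.of (FreeCarrier V X)

/-- The inclusion of generators into the free `V`-algebra. -/
def freeUnit (V : ObjectProperty ModAlg.{u}) (X : Type u) :
    X ⟶ (forget ModAlg.{u}).obj (freeAlg V X) :=
  ↾fun x => FreeCarrier.mk V X (ModalTerm.var x)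

/-- The free `V`-algebra belongs to `V`. -/
theorem freeAlg_mem {V : ObjectProperty ModAlg.{u}} (hV : IsVariety V) (X : Type u) :
    V (freeAlg V X) := by
  obtain ⟨E, hE⟩ := hV
  refine (hE _).2 fun e he (v : ℕ → FreeCarrier V X) => ?_
  obtain ⟨σ, rfl⟩ : ∃ σ : ℕ → ModalTerm X, v = fun n => FreeCarrier.mk V X (σ n) :=
    ⟨fun n => Quotient.out (v n), funext fun n => (Quotient.out_eq (v n)).symm⟩
  refine (FreeCarrier.eval_mk σ e.1).trans (Eq.trans ?_ (FreeCarrier.eval_mk σ e.2).symm)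
  refine Quotient.sound fun A hA w => ?_
  rw [ModalTerm.eval_subst, ModalTerm.eval_subst]
  exact (hE A).1 hA e he _

/-- The universal property of the free `V`-algebra. -/
theorem freeAlg_universal {V : ObjectProperty ModAlg.{u}} (X : Type u) (A : ModAlg.{u})
    (hA : V A) (g : X → A) :
    ∃! h : ModalHom (FreeCarrier V X) A, ∀ x, h (FreeCarrier.mk V X (ModalTerm.var x)) = g x := by
  refine ⟨ModalHom.ofPreserves (fun a => FreeCarrier.evalAll V X a ⟨⟨A, hA⟩, g⟩) rfl
    (by rintro ⟨a⟩ ⟨b⟩; rfl) (by rintro ⟨a⟩; rfl) (by rintro ⟨a⟩; rfl), fun x => rfl,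
    fun h hh => ?_⟩
  · ext a
    obtain ⟨s⟩ := a
    change h (FreeCarrier.mk V X s) = s.eval g
    induction s with
    | var x => exact hh x
    | bot => exact map_bot h
    | sup s t hs ht => exact (map_sup h _ _).trans (congrArg₂ _ hs ht)
    | compl s hs => exact (map_compl' h _).trans (congrArg _ hs)
    | dia s hs => exact (h.map_dia _).trans (congrArg _ hs)

/-! ### Pro-completions -/

/-- The pro-completion of a category, `Pro C = (Ind Cᵒᵖ)ᵒᵖ`. -/
abbrev ProCat (C : Type w) [Category.{u} C] := (Ind Cᵒᵖ)ᵒᵖ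

/-- The canonical embedding of a category into its pro-completion. -/
noncomputable def proEmb (C : Type w) [Category.{u} C] : C ⥤ ProCat C :=
  opOp C ⋙ (Ind.yoneda (C := Cᵒᵖ)).op

section Profinite

variable (V : ObjectProperty ModAlg.{u})

/-- The category `V_f` of finite algebras in `V`. -/
abbrev FinAlg := (finiteMembers V).FullSubcategory

/-- The underlying-set functor of `V_f`, as a presheaf on `V_fᵒᵖ`. -/
def finForget : (FinAlg V)ᵒᵖᵒᵖ ⥤ Type u where
  obj C := C.unop.unop.obj
  map f := ↾fun x => f.unop.unop.hom x

instance (C : (FinAlg V)ᵒᵖᵒᵖ) : ModalAlgebra ((finForget V).obj C) :=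
  inferInstanceAs (ModalAlgebra C.unop.unop.obj)

variable {V}

/-- The action of a morphism of `V_f`, as a morphism of modal algebras. -/
def finForgetHom {C D : (FinAlg V)ᵒᵖᵒᵖ} (f : C ⟶ D) :
    ModalHom ((finForget V).obj C) ((finForget V).obj D) :=
  f.unop.unop.hom.hom'

theorem finForget_map_apply {C D : (FinAlg V)ᵒᵖᵒᵖ} (f : C ⟶ D) (x : (finForget V).obj C) :
    (finForget V).map f x = finForgetHom f x := rfl

/-- The points of a pro-object `P = lim C_i` of `V_f`. As a covariant functor on `V_f`, `P` is
`colim Hom(C_i, -)`, so that natural transformations from `P` to the underlying-set functor are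
the elements of the limit of the underlying sets of the algebras `C_i`. -/
abbrev ProPoint (P : ProCat (FinAlg V)) :=
  (Ind.inclusion (FinAlg V)ᵒᵖ).obj P.unop ⟶ finForget V

namespace ProPoint

instance (P : ProCat (FinAlg V)) : Small.{u} (ProPoint P) := by
  obtain ⟨⟨R⟩⟩ := ((Ind.equivalence (FinAlg V)ᵒᵖ).functor.obj P.unop).property
  let e := R.isColimit.coconePointUniqueUpToIso (colimit.isColimit _)
  dsimp only [colimit.cocone_x] at e
  exact small_map (Iso.homCongr e (Iso.refl (finForget V)))

/-- A point of `P` evaluated at all the maps from `P` to finite algebras. -/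
def evalAll (P : ProCat (FinAlg V)) (p : ProPoint P)
    (q : Σ C : (FinAlg V)ᵒᵖᵒᵖ, ((Ind.inclusion (FinAlg V)ᵒᵖ).obj P.unop).obj C) :
    (finForget V).obj q.1 :=
  p.app q.1 q.2

/-- The modal algebra of points of a pro-object, with pointwise operations. -/
noncomputable instance (P : ProCat (FinAlg V)) : ModalAlgebra (ProPoint P) :=
  ModalAlgebra.ofInjective (α := ProPoint P)
    { app := fun C => ↾fun _ => (⊥ : (finForget V).obj C)
      naturality := fun C D f => by
        ext x
        exact (map_bot (finForgetHom f)).symm }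
    (fun p q =>
      { app := fun C => ↾fun x => p.app C x ⊔ q.app C x
        naturality := fun C D f => by
          ext x
          refine (congrArg₂ (· ⊔ ·) (NatTrans.naturality_apply p f x)
            (NatTrans.naturality_apply q f x)).trans ?_
          exact (map_sup (finForgetHom f) _ _).symm })
    (fun p =>
      { app := fun C => ↾fun x => (p.app C x)ᶜ
        naturality := fun C D f => by
          ext x
          refine (congrArg (·ᶜ) (NatTrans.naturality_apply p f x)).trans ?_
          exact (map_compl' (finForgetHom f) _).symm })
    (fun p =>
      { app := fun C => ↾fun x => ModalAlgebra.dia (p.app C x)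
        naturality := fun C D f => by
          ext x
          refine (congrArg ModalAlgebra.dia (NatTrans.naturality_apply p f x)).trans ?_
          exact ((finForgetHom f).map_dia _).symm })
    (evalAll P)
    (fun p q h => by
      ext C x
      exact congrFun h ⟨C, x⟩)
    rfl (fun _ _ => rfl) (fun _ => rfl) (fun _ => rfl)

/-- A morphism of pro-objects acts on points by precomposition. -/
noncomputable def map {P Q : ProCat (FinAlg V)} (f : P ⟶ Q) :
    ModalHom (ProPoint P) (ProPoint Q) where
  toFun p := (Ind.inclusion (FinAlg V)ᵒᵖ).map f.unop ≫ p
  map_sup' _ _ := rfl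
  map_inf' _ _ := rfl
  map_top' := rfl
  map_bot' := rfl
  map_dia' _ := rfl

end ProPoint

/-- The morphism induced on models of the carriers in a smaller universe. -/
noncomputable def ModalHom.shrink {A B : Type*} [ModalAlgebra A] [ModalAlgebra B] [Small.{w} A]
    [Small.{w} B] (f : ModalHom A B) : ModalHom (Shrink.{w} A) (Shrink.{w} B) :=
  ((equivShrinkHom B).comp f).comp ((equivShrinkHom A).symm (equivShrink A) fun _ => rfl)

variable (V)

/-- The functor `ι : Pro V_f ⥤ MA`, sending a pro-object to its modal algebra of points, in other
words to the limit in `MA` of the finite algebras of which it is the formal limit. -/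
noncomputable def proIncl : ProCat (FinAlg V) ⥤ ModAlg.{u} where
  obj P := ModAlg.of (Shrink.{u} (ProPoint P))
  map f := ⟨(ProPoint.map f).shrink⟩
  map_id P := ModAlg.Hom.ext <| ModalHom.ext fun (a : Shrink.{u} (ProPoint P)) => by
    change equivShrink _ ((Ind.inclusion (FinAlg V)ᵒᵖ).map (𝟙 P.unop) ≫ (equivShrink _).symm a) = a
    simp
  map_comp {P Q R} f g := ModAlg.Hom.ext <| ModalHom.ext fun (a : Shrink.{u} (ProPoint P)) => by
    change equivShrink _ ((Ind.inclusion (FinAlg V)ᵒᵖ).map (g.unop ≫ f.unop) ≫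
        (equivShrink _).symm a) =
      equivShrink _ ((Ind.inclusion (FinAlg V)ᵒᵖ).map g.unop ≫ (equivShrink _).symm
        (equivShrink _ ((Ind.inclusion (FinAlg V)ᵒᵖ).map f.unop ≫ (equivShrink _).symm a)))
    simp

/-- The forgetful functor `Pro V_f ⥤ Set`. -/
noncomputable def proForget : ProCat (FinAlg V) ⥤ Type u :=
  proIncl V ⋙ forget ModAlg.{u}

variable {V}

/-- Points of (the pro-object given by) a finite algebra are elements of the algebra. -/
noncomputable def elemEquivPoint (C : FinAlg V) :
    C.obj ≃ ProPoint ((proEmb (FinAlg V)).obj C) :=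
  (yonedaEquiv (X := op C) (F := finForget V)).symm.trans
    (Iso.homCongr ((Ind.yonedaCompInclusion (C := (FinAlg V)ᵒᵖ)).app (op C)).symm
      (Iso.refl (finForget V)))

/-- The algebra morphism corresponding to a map from (the pro-object given by) `C` to `D`. -/
noncomputable def pointHom (C : FinAlg V) (D : (FinAlg V)ᵒᵖᵒᵖ)
    (x : ((Ind.inclusion (FinAlg V)ᵒᵖ).obj ((proEmb (FinAlg V)).obj C).unop).obj D) :
    ModalHom C.obj ((finForget V).obj D) :=
  (((Ind.yonedaCompInclusion (C := (FinAlg V)ᵒᵖ)).hom.app (op C)).app D x).unop.hom.hom'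

theorem elemEquivPoint_app (C : FinAlg V) (c : C.obj) (D : (FinAlg V)ᵒᵖᵒᵖ) (x) :
    (elemEquivPoint C c).app D x = pointHom C D x c :=
  rfl

/-- The canonical isomorphism from a finite algebra to its algebra of points. -/
noncomputable def elemIso (C : FinAlg V) :
    C.obj ≅ (proIncl V).obj ((proEmb (FinAlg V)).obj C) :=
  ModAlg.isoMk
    ((equivShrinkHom _).comp (ModalHom.ofPreserves (elemEquivPoint C)
      (by ext D x; exact map_bot (pointHom C D x))
      (fun a b => by ext D x; exact map_sup (pointHom C D x) a b)
      (fun a => by ext D x; exact map_compl' (pointHom C D x) a)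
      (fun a => by ext D x; exact (pointHom C D x).map_dia a)))
    ((elemEquivPoint C).trans (equivShrink _)) (fun _ => rfl)

variable (V)

/-- On finite algebras, `ι` is the inclusion `ι_f : V_f ⥤ MA`. -/
noncomputable def inclIso : (finiteMembers V).ι ≅ proEmb (FinAlg V) ⋙ proIncl V :=
  NatIso.ofComponents elemIso fun {C D} f => ModAlg.Hom.ext <| ModalHom.ext fun (c : C.obj) => by
    change equivShrink _ (elemEquivPoint D (f.hom c)) =
      equivShrink _ ((Ind.inclusion (FinAlg V)ᵒᵖ).map ((proEmb (FinAlg V)).map f).unop ≫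
        (equivShrink _).symm (equivShrink _ (elemEquivPoint C c)))
    rw [Equiv.symm_apply_apply]
    congr 1
    ext E x
    have h := congrArg (fun t => t.app E x)
      ((Ind.yonedaCompInclusion (C := (FinAlg V)ᵒᵖ)).hom.naturality f.op)
    exact congrArg (fun g => g.unop.hom.hom' c) h.symm

/-- The diagram `π` of finite `A`-models, on the comma category `A ↓ ι_f`, with values in
`Pro V_f`. -/
noncomputable def finModels (A : ModAlg.{u}) :
    StructuredArrow A (finiteMembers V).ι ⥤ ProCat (FinAlg V) :=
  StructuredArrow.proj A (finiteMembers V).ι ⋙ proEmb (FinAlg V)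

/-- The canonical cone over `ι π` with vertex `A`: the component at a finite `A`-model `A ⟶ C` is
that morphism itself (followed by the identification of `C` with its algebra of points). -/
noncomputable def modelCone (A : ModAlg.{u}) : Cone (finModels V A ⋙ proIncl V) where
  pt := A
  π :=
    { app := fun m => m.hom ≫ (inclIso V).hom.app m.right
      naturality := fun m n f => by
        have h := (inclIso V).hom.naturality f.right
        have w := StructuredArrow.w f
        change 𝟙 A ≫ n.hom ≫ (inclIso V).hom.app n.right =
          (m.hom ≫ (inclIso V).hom.app m.right) ≫ (proEmb (FinAlg V) ⋙ proIncl V).map f.right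
        rw [Category.id_comp, Category.assoc, ← h, ← w, Category.assoc] }

end Profinite

/-! ### Closure properties of varieties -/

/-! An object of `ProCat (FinAlg V)` amounts to a covariant functor G from V_f to sets with
cofiltered (and suitably small) category of elements; its points are the natural transformations
from G to `finForget`. Kripke duality gives the picture: finite modal algebras are powersets of
finite frames, G is a frame glued from finite ones, G(C) is the set of p-morphisms to it from the
frame of C, points are its subsets, and quotients of C are generated subframes.

The free object on X is the functor C ↦ (X → C). Its category of elements is cofiltered because V_f
has finite limits, and is F_V(X) ↓ ι_f by the universal property of F_V(X). So a map out of it is a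
compatible family indexed by the finite models of F_V(X) (`freePro_hom_ext`, `exists_freePro_hom`).
Taking the presheaf of a pro-object as target gives the limit in Pro V_f; taking `finForget` gives
the limit in MA. The generator x has component h(e_X(x)) at h, which identifies the unit.

Monadicity comes from the crude monadicity theorem for reflexive pairs. Coequalizers in Pro V_f are
pointwise equalizers of functors. As in Paré's proof that the contravariant powerset functor is
monadic, splittings are direct images: along a closed inclusion (dually, a generated subframe) every
point has a least extension, natural by `map_extendVal` and satisfying base change
(`comp_extend_of_pullback`). Isomorphisms are reflected because points separate elements
(`eq_of_forall_point`), so that a map bijective on points is a closed inclusion, and because the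
extension of the greatest point must then be the greatest point, which forces surjectivity
(`app_bijective_of_bijective_on_points`). -/

theorem ModalTerm.map_eval {X : Type*} {A B : Type*} [ModalAlgebra A] [ModalAlgebra B]
    (f : ModalHom A B) (v : X → A) (s : ModalTerm X) :
    f (s.eval v) = s.eval (fun x => f (v x)) := by
  induction s with
  | var x => rfl
  | bot => exact map_bot f
  | sup s t hs ht => exact (map_sup f _ _).trans (congrArg₂ _ hs ht)
  | compl s hs => exact (map_compl' f _).trans (congrArg _ hs)
  | dia s hs => exact (f.map_dia _).trans (congrArg _ hs)

namespace IsVariety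

variable {V : ObjectProperty ModAlg.{u}} (hV : IsVariety V)
include hV

theorem of_injective {A B : Type u} [ModalAlgebra A] [ModalAlgebra B] (f : ModalHom A B)
    (hf : Function.Injective f) (hB : V (ModAlg.of B)) : V (ModAlg.of A) := by
  obtain ⟨E, hE⟩ := hV
  refine (hE _).2 fun e he v => hf ?_
  rw [ModalTerm.map_eval, ModalTerm.map_eval]
  exact (hE _).1 hB e he _

theorem of_surjective {A B : Type u} [ModalAlgebra A] [ModalAlgebra B] (f : ModalHom A B)
    (hf : Function.Surjective f) (hA : V (ModAlg.of A)) : V (ModAlg.of B) := by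
  obtain ⟨E, hE⟩ := hV
  refine (hE _).2 fun e he v => ?_
  obtain ⟨w, rfl⟩ : ∃ w : ℕ → A, v = fun n => f (w n) :=
    ⟨fun n => (hf (v n)).choose, funext fun n => (hf (v n)).choose_spec.symm⟩
  rw [← ModalTerm.map_eval, ← ModalTerm.map_eval]
  exact congrArg f ((hE _).1 hA e he _)

end IsVariety

namespace ModalHom

/-- The projections of a product of modal algebras. -/
def proj {ι : Type*} (B : ι → Type*) [∀ i, ModalAlgebra (B i)] (i : ι) :
    ModalHom (∀ i, B i) (B i) :=
  ofPreserves (fun b => b i) rfl (fun _ _ => rfl) (fun _ => rfl) (fun _ => rfl)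

/-- The morphism to a product of modal algebras with given components. -/
def pi {ι : Type*} {A : Type*} {B : ι → Type*} [ModalAlgebra A] [∀ i, ModalAlgebra (B i)]
    (f : ∀ i, ModalHom A (B i)) : ModalHom A (∀ i, B i) :=
  ofPreserves (fun a i => f i a) (funext fun i => map_bot (f i))
    (fun a b => funext fun i => map_sup (f i) a b)
    (fun a => funext fun i => map_compl' (f i) a)
    (fun a => funext fun i => (f i).map_dia a)

end ModalHom

theorem IsVariety.pi {V : ObjectProperty ModAlg.{u}} (hV : IsVariety V) {ι : Type u}
    (B : ι → Type u) [∀ i, ModalAlgebra (B i)] (hB : ∀ i, V (ModAlg.of (B i))) :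
    V (ModAlg.of (∀ i, B i)) := by
  obtain ⟨E, hE⟩ := hV
  refine (hE _).2 fun e he v => funext fun i => ?_
  refine (ModalTerm.map_eval (ModalHom.proj B i) v e.1).trans
    (Eq.trans ?_ (ModalTerm.map_eval (ModalHom.proj B i) v e.2).symm)
  exact (hE _).1 (hB i) e he _

/-! ### Equalizers and relativizations of modal algebras -/

namespace ModalHom

variable {A B : Type*} [ModalAlgebra A] [ModalAlgebra B]

/-- The equalizer of two morphisms of modal algebras. -/
def EqLocus (f g : ModalHom A B) : Type _ := {a : A // f a = g a}

instance (f g : ModalHom A B) : ModalAlgebra (EqLocus f g) :=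
  ModalAlgebra.ofInjective (α := EqLocus f g) (β := A)
    ⟨⊥, by simp⟩
    (fun a b => ⟨a.1 ⊔ b.1, by rw [map_sup, map_sup, a.2, b.2]⟩)
    (fun a => ⟨a.1ᶜ, by rw [map_compl', map_compl', a.2]⟩)
    (fun a => ⟨ModalAlgebra.dia a.1, by rw [map_dia, map_dia, a.2]⟩)
    Subtype.val Subtype.val_injective rfl (fun _ _ => rfl) (fun _ => rfl) (fun _ => rfl)

/-- The inclusion of the equalizer of two morphisms. -/
def eqLocusIncl (f g : ModalHom A B) : ModalHom (EqLocus f g) A :=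
  ofPreserves Subtype.val rfl (fun _ _ => rfl) (fun _ => rfl) (fun _ => rfl)

end ModalHom

namespace ModalAlgebra

variable {A : Type*} [ModalAlgebra A]

theorem dia_mono {a b : A} (h : a ≤ b) : dia a ≤ dia b := by
  rw [← sup_eq_right.2 h, dia_sup]
  exact le_sup_left

/-- The dual operator `□`. -/
def box (a : A) : A := (dia aᶜ)ᶜ

theorem dia_inf_box_le (a b : A) : dia a ⊓ box b ≤ dia (a ⊓ b) := by
  have h : dia a ≤ dia (a ⊓ b) ⊔ dia bᶜ := by
    rw [← dia_sup]
    apply dia_mono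
    rw [sup_inf_right, sup_compl_eq_top, inf_top_eq]
    exact le_sup_left
  rw [box, ← sdiff_eq]
  exact sdiff_le_iff.2 (h.trans_eq (sup_comm _ _))

/-- Dually, `u ≤ box u` says that successors of worlds in `u` stay in `u`, so within `u` the
operator sees only the part of `a` inside `u`. This is what makes `restrict` a morphism. -/
theorem dia_inf {u : A} (hu : u ≤ box u) (a : A) : dia a ⊓ u = dia (a ⊓ u) ⊓ u :=
  le_antisymm (le_inf ((inf_le_inf_left _ hu).trans (dia_inf_box_le a u)) inf_le_right)
    (inf_le_inf_right _ (dia_mono inf_le_left))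

/-- The relativization of a modal algebra to an element `u` with `u ≤ □ u`. -/
def Relativization (u : A) (_ : u ≤ box u) : Type _ := {a : A // a ≤ u}

namespace Relativization

variable {u : A} {hu : u ≤ box u}

@[ext]
theorem ext {a b : Relativization u hu} (h : a.1 = b.1) : a = b := Subtype.ext h

instance : BooleanAlgebra (Relativization u hu) where
  le a b := a.1 ≤ b.1
  le_refl a := le_refl a.1
  le_trans a b c := le_trans (a := a.1)
  le_antisymm a b h k := ext (le_antisymm h k)
  sup a b := ⟨a.1 ⊔ b.1, sup_le a.2 b.2⟩
  inf a b := ⟨a.1 ⊓ b.1, inf_le_left.trans a.2⟩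
  le_sup_left a b := le_sup_left (a := a.1)
  le_sup_right a b := le_sup_right (a := a.1)
  sup_le a b c h k := sup_le (a := a.1) h k
  inf_le_left a b := inf_le_left (a := a.1)
  inf_le_right a b := inf_le_right (a := a.1)
  le_inf a b c h k := le_inf (α := A) h k
  le_sup_inf a b c := le_sup_inf (x := a.1)
  top := ⟨u, le_rfl⟩
  bot := ⟨⊥, bot_le⟩
  compl a := ⟨u \ a.1, sdiff_le⟩
  le_top a := a.2
  bot_le a := bot_le (a := a.1)
  inf_compl_le_bot a := (inf_sdiff_self_right (x := a.1)).le
  top_le_sup_compl a := by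
    change u ≤ a.1 ⊔ u \ a.1
    rw [sup_sdiff_self_right]
    exact le_sup_right

instance : ModalAlgebra (Relativization u hu) where
  dia a := ⟨dia a.1 ⊓ u, inf_le_right⟩
  dia_sup a b := ext <| by
    change dia (a.1 ⊔ b.1) ⊓ u = dia a.1 ⊓ u ⊔ dia b.1 ⊓ u
    rw [dia_sup, inf_sup_right]
  dia_bot := ext <| by
    change dia ⊥ ⊓ u = ⊥
    rw [dia_bot, bot_inf_eq]

variable (u hu)

/-- The canonical morphism onto a relativization. -/
def restrict : ModalHom A (Relativization u hu) :=
  ModalHom.ofPreserves (fun a => ⟨a ⊓ u, inf_le_right⟩) (ext (bot_inf_eq u))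
    (fun a b => ext (inf_sup_right a b u))
    (fun a => ext <| by
      change aᶜ ⊓ u = u \ (a ⊓ u)
      rw [sdiff_inf_self_right, sdiff_eq, inf_comm])
    (fun a => ext (dia_inf hu a))

variable {u hu}

/-- A morphism sending `u` to `⊤` descends to the relativization to `u`. -/
def desc {B : Type*} [ModalAlgebra B] (f : ModalHom A B) (hf : f u = ⊤) :
    ModalHom (Relativization u hu) B :=
  ModalHom.ofPreserves (fun a => f a.1) (map_bot f) (fun a b => map_sup f a.1 b.1)
    (fun a => by
      change f (u \ a.1) = _
      rw [sdiff_eq, map_inf, hf, top_inf_eq, map_compl'])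
    (fun a => by
      change f (dia a.1 ⊓ u) = _
      rw [map_inf, hf, inf_top_eq, f.map_dia])

/-- The morphism induced by a morphism `f` on the relativizations to `u` and `f u`. -/
def map {B : Type*} [ModalAlgebra B] (f : ModalHom A B) (hu' : f u ≤ box (f u)) :
    ModalHom (Relativization u hu) (Relativization (f u) hu') :=
  desc ((restrict (f u) hu').comp f) (ext (inf_idem (f u)))

end Relativization

end ModalAlgebra

theorem ModalHom.map_box {A B : Type*} [ModalAlgebra A] [ModalAlgebra B] (f : ModalHom A B)
    (a : A) : f (ModalAlgebra.box a) = ModalAlgebra.box (f a) := by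
  rw [ModalAlgebra.box, map_compl', f.map_dia, map_compl', ModalAlgebra.box]

/-- The elements sent to `⊤` form a filter, and in a finite algebra a filter is generated by the
meet of its members. -/
theorem ModalHom.exists_kernel {A B : Type*} [ModalAlgebra A] [Finite A] [ModalAlgebra B]
    (f : ModalHom A B) : ∃ u : A, ∀ a, f a = ⊤ ↔ u ≤ a := by
  have hfin : {a : A | f a = ⊤}.Finite := Set.toFinite _
  refine ⟨hfin.toFinset.inf _root_.id, fun a => ⟨fun h => ?_, fun h => ?_⟩⟩
  · exact Finset.inf_le (f := _root_.id) (hfin.mem_toFinset.2 h)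
  · refine top_le_iff.1 (le_trans ?_ (OrderHomClass.mono f h))
    rw [map_finset_inf]
    exact Finset.le_inf fun b hb => (hfin.mem_toFinset.1 hb).ge

/-! ### The category of finite algebras in a variety -/

section FiniteAlgebras

variable {V : ObjectProperty ModAlg.{u}}

instance (C : (FinAlg V)ᵒᵖᵒᵖ) : Finite ((finForget V).obj C) := C.unop.unop.property.2

theorem finForget_mem (C : (FinAlg V)ᵒᵖᵒᵖ) : V (ModAlg.of ((finForget V).obj C)) :=
  C.unop.unop.property.1

/-- A finite algebra in `V`, as an object of the double opposite of `V_f`. -/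
def finAlgOf (A : Type u) [ModalAlgebra A] [Finite A] (hA : V (ModAlg.of A)) : (FinAlg V)ᵒᵖᵒᵖ :=
  op (op ⟨ModAlg.of A, hA, ‹_›⟩)

/-- A morphism of modal algebras, as a morphism of the double opposite of `V_f`. -/
def finAlgHom {C D : (FinAlg V)ᵒᵖᵒᵖ} (f : ModalHom ((finForget V).obj C) ((finForget V).obj D)) :
    C ⟶ D :=
  Quiver.Hom.op (Quiver.Hom.op (ObjectProperty.homMk ⟨f⟩))

theorem finForgetHom_comp {C D E : (FinAlg V)ᵒᵖᵒᵖ} (f : C ⟶ D) (g : D ⟶ E)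
    (x : (finForget V).obj C) :
    finForgetHom (f ≫ g) x = finForgetHom g (finForgetHom f x) := rfl

theorem finAlg_hom_ext {C D : (FinAlg V)ᵒᵖᵒᵖ} {f g : C ⟶ D}
    (h : ∀ x, finForgetHom f x = finForgetHom g x) : f = g := by
  apply Quiver.Hom.unop_inj
  apply Quiver.Hom.unop_inj
  apply ObjectProperty.hom_ext
  apply ModAlg.Hom.ext
  exact ModalHom.ext h

theorem finAlg_cancel_surjective {B C D : (FinAlg V)ᵒᵖᵒᵖ} {r : B ⟶ C}
    (hr : Function.Surjective (finForgetHom r)) {f g : C ⟶ D} (h : r ≫ f = r ≫ g) : f = g := by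
  refine finAlg_hom_ext fun x => ?_
  obtain ⟨y, rfl⟩ := hr x
  rw [← finForgetHom_comp, ← finForgetHom_comp, h]

/-- A morphism into `D` whose image is contained in that of an injective morphism factors. -/
theorem exists_factor {B C D : (FinAlg V)ᵒᵖᵒᵖ} {j : C ⟶ D}
    (hj : Function.Injective (finForgetHom j)) (f : B ⟶ D)
    (h : ∀ b, ∃ c, finForgetHom j c = finForgetHom f b) : ∃ g : B ⟶ C, g ≫ j = f := by
  choose g hg using h
  refine ⟨finAlgHom (ModalHom.ofPreserves g (hj ?_) (fun a b => hj ?_) (fun a => hj ?_)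
    (fun a => hj ?_)), finAlg_hom_ext hg⟩
  · rw [hg, map_bot, map_bot]
  · rw [hg, map_sup, map_sup, hg, hg]
  · rw [hg, map_compl', map_compl', hg]
  · rw [hg, ModalHom.map_dia, ModalHom.map_dia, hg]

/-- Arbitrary finite index types are needed: the empty one gives a terminal algebra, `ULift Bool`
gives binary products, and `app_bijective_of_bijective_on_points` uses the nonzero elements of an
algebra. -/
theorem exists_prod (hV : IsVariety V) {ι : Type u} [Finite ι] (B : ι → (FinAlg V)ᵒᵖᵒᵖ) :
    ∃ (P : (FinAlg V)ᵒᵖᵒᵖ) (p : ∀ i, P ⟶ B i),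
      (∀ x y, (∀ i, finForgetHom (p i) x = finForgetHom (p i) y) → x = y) ∧
      (∀ b : ∀ i, (finForget V).obj (B i), ∃ x, ∀ i, finForgetHom (p i) x = b i) ∧
      ∀ (C : (FinAlg V)ᵒᵖᵒᵖ) (f : ∀ i, C ⟶ B i), ∃ g : C ⟶ P, ∀ i, g ≫ p i = f i := by
  let P : (FinAlg V)ᵒᵖᵒᵖ := finAlgOf (∀ i, (finForget V).obj (B i))
    (hV.pi _ fun i => finForget_mem (B i))
  refine ⟨P, fun i => finAlgHom (C := P) (ModalHom.proj _ i), fun x y h => funext h,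
    fun b => ⟨b, fun i => rfl⟩, fun C f => ⟨finAlgHom (D := P) (ModalHom.pi fun i =>
    finForgetHom (f i)), fun i => rfl⟩⟩

theorem exists_equalizer (hV : IsVariety V) {C D : (FinAlg V)ᵒᵖᵒᵖ} (f g : C ⟶ D) :
    ∃ (B : (FinAlg V)ᵒᵖᵒᵖ) (j : B ⟶ C), j ≫ f = j ≫ g ∧ Function.Injective (finForgetHom j) ∧
      ∀ c, finForgetHom f c = finForgetHom g c → ∃ b, finForgetHom j b = c := by
  let A := ModalHom.EqLocus (finForgetHom f) (finForgetHom g)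
  let i : ModalHom A _ := ModalHom.eqLocusIncl (finForgetHom f) (finForgetHom g)
  have hi : Function.Injective i := Subtype.val_injective
  have : Finite A := Finite.of_injective _ hi
  let B : (FinAlg V)ᵒᵖᵒᵖ := finAlgOf A (hV.of_injective i hi (finForget_mem C))
  exact ⟨B, finAlgHom (C := B) i, finAlg_hom_ext fun x => x.2, hi, fun c hc => ⟨⟨c, hc⟩, rfl⟩⟩

open ModalAlgebra in
/-- The cobase change of a quotient of a finite algebra `C` along `m : C ⟶ D`, where the quotient is
the image of a morphism `q`, is a relativization of `D`. -/
theorem exists_relativization (hV : IsVariety V) {C C' D : (FinAlg V)ᵒᵖᵒᵖ} (q : C ⟶ C')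
    (m : C ⟶ D) :
    ∃ (R S : (FinAlg V)ᵒᵖᵒᵖ) (r : C ⟶ R) (j : R ⟶ C') (s : D ⟶ S) (m' : R ⟶ S),
      r ≫ j = q ∧ Function.Injective (finForgetHom j) ∧ m ≫ s = r ≫ m' ∧
      ∀ b, ∃ c, finForgetHom r c = b ∧
        ∀ d, finForgetHom m' b ≤ finForgetHom s d → finForgetHom m c ≤ d := by
  obtain ⟨v, hv⟩ := (finForgetHom q).exists_kernel
  have hqv : finForgetHom q v = ⊤ := (hv v).2 le_rfl
  have hu : v ≤ box v := (hv _).1 <| by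
    rw [ModalHom.map_box, hqv, box, compl_top, dia_bot, compl_bot]
  have hmu : finForgetHom m v ≤ box (finForgetHom m v) := by
    rw [← ModalHom.map_box]
    exact OrderHomClass.mono _ hu
  have hR : Function.Surjective (Relativization.restrict v hu) := fun a =>
    ⟨a.1, Relativization.ext (inf_eq_left.2 a.2)⟩
  have hS : Function.Surjective (Relativization.restrict _ hmu) := fun a =>
    ⟨a.1, Relativization.ext (inf_eq_left.2 a.2)⟩
  have : Finite (Relativization v hu) := Finite.of_surjective _ hR
  have : Finite (Relativization _ hmu) := Finite.of_surjective _ hS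
  let R : (FinAlg V)ᵒᵖᵒᵖ :=
    finAlgOf (Relativization v hu) (hV.of_surjective _ hR (finForget_mem C))
  let S : (FinAlg V)ᵒᵖᵒᵖ :=
    finAlgOf (Relativization _ hmu) (hV.of_surjective _ hS (finForget_mem D))
  refine ⟨R, S, finAlgHom (D := R) (Relativization.restrict v hu),
    finAlgHom (C := R) (Relativization.desc (finForgetHom q) hqv),
    finAlgHom (D := S) (Relativization.restrict _ hmu),
    finAlgHom (C := R) (D := S) (Relativization.map (finForgetHom m) hmu), ?_, ?_, ?_, ?_⟩
  · refine finAlg_hom_ext fun x => ?_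
    change finForgetHom q (x ⊓ v) = finForgetHom q x
    rw [map_inf, hqv, inf_top_eq]
  · intro a b h
    change finForgetHom q a.1 = finForgetHom q b.1 at h
    have key : ∀ a b : Relativization v hu, finForgetHom q a.1 = finForgetHom q b.1 →
        a.1 ≤ b.1 := by
      intro a b h
      have hle : v ≤ a.1ᶜ ⊔ b.1 := (hv _).1 (by rw [map_sup, map_compl', h, compl_sup_eq_top])
      have := le_inf le_rfl (a.2.trans hle)
      rw [inf_sup_left, inf_compl_self, bot_sup_eq] at this
      exact this.trans inf_le_right
    exact Relativization.ext (hu := hu) (le_antisymm (key a b h) (key b a h.symm))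
  · refine finAlg_hom_ext fun x => Relativization.ext (hu := hmu) ?_
    change finForgetHom m x ⊓ finForgetHom m v = finForgetHom m (x ⊓ v) ⊓ finForgetHom m v
    rw [map_inf, inf_assoc, inf_idem]
  · intro b
    -- The least lift of `b` lies below `v`, so an inequality in `S`, that is modulo `m v`, is
    -- already one in `D`.
    refine ⟨b.1, Relativization.ext (hu := hu) (inf_eq_left.2 b.2), fun d hd => ?_⟩
    have h1 : finForgetHom m b.1 ⊓ finForgetHom m v ≤ d ⊓ finForgetHom m v := hd
    rw [← map_inf, inf_eq_left.2 b.2] at h1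
    exact h1.trans inf_le_left

theorem exists_image (hV : IsVariety V) {C C' : (FinAlg V)ᵒᵖᵒᵖ} (q : C ⟶ C') :
    ∃ (R : (FinAlg V)ᵒᵖᵒᵖ) (r : C ⟶ R) (j : R ⟶ C'), r ≫ j = q ∧
      Function.Surjective (finForgetHom r) ∧ Function.Injective (finForgetHom j) := by
  obtain ⟨R, _, r, j, _, _, h, hj, _, hr⟩ := exists_relativization hV q (𝟙 C)
  exact ⟨R, r, j, h, fun b => (hr b).imp fun _ h => h.1, hj⟩

end FiniteAlgebras

/-! ### Presheaves with cofiltered categories of elements -/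

section Elements

variable {V : ObjectProperty ModAlg.{u}}

section General

variable {𝒞 : Type*} [Category* 𝒞] (G : 𝒞 ⥤ Type u)

theorem CategoryTheory.CategoryOfElements.isCofiltered (C₀ : 𝒞) (x₀ : G.obj C₀)
    (hprod : ∀ {C D : 𝒞} (x : G.obj C) (y : G.obj D), ∃ (B : 𝒞) (z : G.obj B) (k : B ⟶ C)
      (l : B ⟶ D), G.map k z = x ∧ G.map l z = y)
    (heq : ∀ {C D : 𝒞} (f g : C ⟶ D) (x : G.obj C), G.map f x = G.map g x →
      ∃ (B : 𝒞) (z : G.obj B) (k : B ⟶ C), G.map k z = x ∧ k ≫ f = k ≫ g) :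
    IsCofiltered G.Elements where
  nonempty := ⟨⟨C₀, x₀⟩⟩
  cone_objs X Y := by
    obtain ⟨B, z, k, l, hk, hl⟩ := hprod X.2 Y.2
    exact ⟨⟨B, z⟩, CategoryOfElements.homMk _ _ k hk, CategoryOfElements.homMk _ _ l hl, trivial⟩
  cone_maps X Y f g := by
    obtain ⟨B, z, k, hk, h⟩ := heq f.1 g.1 X.2 (f.2.trans g.2.symm)
    exact ⟨⟨B, z⟩, CategoryOfElements.homMk _ _ k hk, CategoryOfElements.ext _ _ _ h⟩

variable [IsCofiltered G.Elements]

theorem exists_common_element {C D : 𝒞} (x : G.obj C) (y : G.obj D) :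
    ∃ (B : 𝒞) (z : G.obj B) (k : B ⟶ C) (l : B ⟶ D), G.map k z = x ∧ G.map l z = y := by
  let X : G.Elements := ⟨C, x⟩
  let Y : G.Elements := ⟨D, y⟩
  exact ⟨_, _, (IsCofiltered.minToLeft X Y).1, (IsCofiltered.minToRight X Y).1,
    (IsCofiltered.minToLeft X Y).2, (IsCofiltered.minToRight X Y).2⟩

theorem exists_equalizing_element {C D : 𝒞} (f g : C ⟶ D) (x : G.obj C)
    (h : G.map f x = G.map g x) :
    ∃ (B : 𝒞) (z : G.obj B) (k : B ⟶ C), G.map k z = x ∧ k ≫ f = k ≫ g := by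
  let X : G.Elements := ⟨C, x⟩
  let Y : G.Elements := ⟨D, G.map f x⟩
  let f' : X ⟶ Y := ⟨f, rfl⟩
  let g' : X ⟶ Y := ⟨g, h.symm⟩
  exact ⟨_, _, (IsCofiltered.eqHom f' g').1, (IsCofiltered.eqHom f' g').2,
    congrArg Subtype.val (IsCofiltered.eq_condition f' g')⟩

end General

variable (G : (FinAlg V)ᵒᵖᵒᵖ ⥤ Type u) [IsCofiltered G.Elements]

/-- Jointly injective families of maps of finite algebras act jointly injectively. -/
theorem jointly_injective_of_isCofiltered {ι : Type*} [Finite ι] {C : (FinAlg V)ᵒᵖᵒᵖ}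
    {D : ι → (FinAlg V)ᵒᵖᵒᵖ} (p : ∀ i, C ⟶ D i)
    (hp : ∀ x y, (∀ i, finForgetHom (p i) x = finForgetHom (p i) y) → x = y)
    {x y : G.obj C} (h : ∀ i, G.map (p i) x = G.map (p i) y) : x = y := by
  obtain ⟨B, z, k, l, rfl, rfl⟩ := exists_common_element G x y
  -- The finitely many pairs `k ≫ p i`, `l ≫ p i` are equalized one after another, each time
  -- replacing `z` by an element mapping to it.
  have h' : ∀ s : Set ι, ∃ (B' : _) (z' : G.obj B') (e : B' ⟶ B), G.map e z' = z ∧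
      ∀ i ∈ s, e ≫ k ≫ p i = e ≫ l ≫ p i := by
    intro s
    induction s, s.toFinite using Set.Finite.induction_on with
    | empty => exact ⟨B, z, 𝟙 B, by simp, by simp⟩
    | @insert i s _ _ ih =>
      obtain ⟨B', z', e, rfl, he⟩ := ih
      obtain ⟨B'', z'', e', rfl, he'⟩ := exists_equalizing_element G (e ≫ k ≫ p i) (e ≫ l ≫ p i)
        z' (by simpa using h i)
      refine ⟨B'', z'', e' ≫ e, by simp, fun i' hi' => ?_⟩
      obtain rfl | hi' := hi'
      · simpa using he'
      · simp [he i' hi']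
  obtain ⟨B', z', e, rfl, he⟩ := h' Set.univ
  have : e ≫ k = e ≫ l := finAlg_hom_ext fun b => hp _ _ fun i => by
    rw [← finForgetHom_comp, ← finForgetHom_comp, Category.assoc, Category.assoc, he i trivial]
  rw [← Functor.map_comp_apply, ← Functor.map_comp_apply, this]

theorem map_injective_of_isCofiltered {C D : (FinAlg V)ᵒᵖᵒᵖ} {j : C ⟶ D}
    (hj : Function.Injective (finForgetHom j)) : Function.Injective (G.map j) := fun _ _ h =>
  jointly_injective_of_isCofiltered G (ι := Unit) (fun _ => j)
    (fun _ _ h => hj (h ())) fun _ => h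

/-- Finitely many elements come from a single one, whose maps to the factors pass through the
product. With `jointly_injective_of_isCofiltered` this says that `G` preserves finite products. -/
theorem map_prod_surjective {ι : Type*} [Finite ι] {P : (FinAlg V)ᵒᵖᵒᵖ}
    {B : ι → (FinAlg V)ᵒᵖᵒᵖ}
    (p : ∀ i, P ⟶ B i)
    (hP : ∀ (C : (FinAlg V)ᵒᵖᵒᵖ) (f : ∀ i, C ⟶ B i), ∃ g : C ⟶ P, ∀ i, g ≫ p i = f i)
    (b : ∀ i, G.obj (B i)) : ∃ x, ∀ i, G.map (p i) x = b i := by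
  have h' : ∀ s : Set ι, ∃ (C : _) (z : G.obj C), ∀ i ∈ s, ∃ k : C ⟶ B i, G.map k z = b i := by
    intro s
    induction s, s.toFinite using Set.Finite.induction_on with
    | empty => exact ⟨_, (IsCofiltered.nonempty (C := G.Elements)).some.2, by simp⟩
    | @insert i s _ _ ih =>
      obtain ⟨B', z', he⟩ := ih
      obtain ⟨B'', z'', k, l, hk, rfl⟩ := exists_common_element G (b i) z'
      refine ⟨B'', z'', fun i' hi' => ?_⟩
      obtain rfl | hi' := hi'
      · exact ⟨k, hk⟩
      · obtain ⟨k', hk'⟩ := he i' hi'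
        exact ⟨l ≫ k', by simpa using hk'⟩
  obtain ⟨C, z, h⟩ := h' Set.univ
  choose k hk using fun i => h i trivial
  obtain ⟨g, hg⟩ := hP C k
  exact ⟨G.map g z, fun i => by rw [← Functor.map_comp_apply, hg, hk]⟩

end Elements

/-! ### Extension of points along inclusions of presheaves -/

section Extension

variable {V : ObjectProperty ModAlg.{u}}

section Values

variable {G : (FinAlg V)ᵒᵖᵒᵖ ⥤ Type u} (E : ∀ C, Set (G.obj C))
  (b : ∀ C, G.obj C → (finForget V).obj C)

/-- The value at `x` of the least extension of a family of elements `b` indexed by `E`. -/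
noncomputable def extendVal (C : (FinAlg V)ᵒᵖᵒᵖ) (x : G.obj C) : (finForget V).obj C :=
  (Set.toFinite {a : (finForget V).obj C | ∀ (D : (FinAlg V)ᵒᵖᵒᵖ) (q : C ⟶ D), G.map q x ∈ E D →
    b D (G.map q x) ≤ finForgetHom q a}).toFinset.inf id

variable {E b}

theorem extendVal_le {C : (FinAlg V)ᵒᵖᵒᵖ} {x : G.obj C} {a : (finForget V).obj C}
    (h : ∀ (D : (FinAlg V)ᵒᵖᵒᵖ) (q : C ⟶ D), G.map q x ∈ E D →
      b D (G.map q x) ≤ finForgetHom q a) : extendVal E b C x ≤ a :=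
  Finset.inf_le (f := id) ((Set.Finite.mem_toFinset _).2 h)

/-- Each `q` preserves finite meets, so the meet of all solutions of the defining inequalities is
itself a solution. -/
theorem le_map_extendVal {C D : (FinAlg V)ᵒᵖᵒᵖ} {x : G.obj C} (q : C ⟶ D)
    (h : G.map q x ∈ E D) : b D (G.map q x) ≤ finForgetHom q (extendVal E b C x) := by
  rw [extendVal, map_finset_inf]
  exact Finset.le_inf fun a ha => (Set.Finite.mem_toFinset _).1 ha D q h

theorem extendVal_congr {E' : ∀ C, Set (G.obj C)} {b' : ∀ C, G.obj C → (finForget V).obj C}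
    (hE : ∀ C x, x ∈ E C ↔ x ∈ E' C) (hb : ∀ C, ∀ x ∈ E C, b C x = b' C x)
    (C : (FinAlg V)ᵒᵖᵒᵖ) (x : G.obj C) : extendVal E b C x = extendVal E' b' C x := by
  obtain rfl : E = E' := funext fun C => Set.ext (hE C)
  refine le_antisymm (extendVal_le fun D q h => ?_) (extendVal_le fun D q h => ?_)
  · rw [hb D _ h]
    exact le_map_extendVal q h
  · rw [← hb D _ h]
    exact le_map_extendVal q h

/-- The value at an element depends only on its images under maps of algebras, so by naturality it
can be computed after pulling `E` and `b` back along `α`. Base change rests on this. -/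
theorem extendVal_app {H : (FinAlg V)ᵒᵖᵒᵖ ⥤ Type u} (α : H ⟶ G) (C : (FinAlg V)ᵒᵖᵒᵖ)
    (x : H.obj C) : extendVal E b C (α.app C x) =
      extendVal (fun D => {y | α.app D y ∈ E D}) (fun D y => b D (α.app D y)) C x := by
  refine le_antisymm (extendVal_le fun D q h => ?_) (extendVal_le fun D q h => ?_)
  · rw [← NatTrans.naturality_apply] at h ⊢
    exact le_map_extendVal (G := H) (E := fun D => {y | α.app D y ∈ E D})
      (b := fun D y => b D (α.app D y)) q h
  · change α.app D _ ∈ E D at h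
    rw [NatTrans.naturality_apply] at h ⊢
    exact le_map_extendVal q h

theorem extendVal_of_mem (hE : ∀ {C D : (FinAlg V)ᵒᵖᵒᵖ} (m : C ⟶ D), ∀ x ∈ E C, G.map m x ∈ E D)
    (hb : ∀ {C D : (FinAlg V)ᵒᵖᵒᵖ} (m : C ⟶ D), ∀ x ∈ E C,
      b D (G.map m x) = finForgetHom m (b C x)) {C : (FinAlg V)ᵒᵖᵒᵖ} {x : G.obj C} (hx : x ∈ E C) :
    extendVal E b C x = b C x := by
  refine le_antisymm (extendVal_le fun D q _ => (hb q x hx).le) ?_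
  have h := le_map_extendVal (E := E) (b := b) (x := x) (𝟙 C) (hE _ x hx)
  rwa [Functor.map_id_apply] at h

/-- One inequality is formal. For the other, think of a world `d` of `D` lying over a world `c` in
the direct image: `c` belongs to a generated subframe that maps into `E`, and the preimage of that
subframe in `D` is again generated and contains `d`. `exists_relativization` is the algebraic form
of this preimage. -/
theorem map_extendVal (hV : IsVariety V)
    (hE : ∀ {C D : (FinAlg V)ᵒᵖᵒᵖ} (m : C ⟶ D), ∀ x ∈ E C, G.map m x ∈ E D)
    (hE' : ∀ {C D : (FinAlg V)ᵒᵖᵒᵖ} (j : C ⟶ D), Function.Injective (finForgetHom j) →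
      ∀ x, G.map j x ∈ E D → x ∈ E C)
    (hb : ∀ {C D : (FinAlg V)ᵒᵖᵒᵖ} (m : C ⟶ D), ∀ x ∈ E C,
      b D (G.map m x) = finForgetHom m (b C x))
    {C D : (FinAlg V)ᵒᵖᵒᵖ} (m : C ⟶ D) (x : G.obj C) :
    extendVal E b D (G.map m x) = finForgetHom m (extendVal E b C x) := by
  refine le_antisymm (extendVal_le fun D' q h => ?_) ?_
  · rw [← Functor.map_comp_apply] at h ⊢
    exact le_map_extendVal _ h
  by_contra hle
  obtain ⟨d, hd, hdle⟩ := (eq_bot_or_exists_atom_le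
    (finForgetHom m (extendVal E b C x) \ extendVal E b D (G.map m x))).resolve_left
    fun h => hle (sdiff_eq_bot_iff.1 h)
  -- the least element `c` with `d ≤ m c` is the atom of `C` corresponding to `d`
  have hfin : {c : (finForget V).obj C | d ≤ finForgetHom m c}.Finite := Set.toFinite _
  let c := hfin.toFinset.inf id
  have hdc : d ≤ finForgetHom m c := by
    rw [map_finset_inf]
    exact Finset.le_inf fun c hc => hfin.mem_toFinset.1 hc
  have hc : ∀ c', d ≤ finForgetHom m c' → c ≤ c' := fun c' h =>
    Finset.inf_le (f := id) (hfin.mem_toFinset.2 h)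
  have hlt : ¬ extendVal E b C x ≤ extendVal E b C x \ c := fun h => by
    have h1 := hc _ (hdle.trans sdiff_le)
    have h2 : Disjoint c c := disjoint_sdiff_self_left.mono_left (h1.trans h)
    rw [disjoint_self.1 h2, map_bot] at hdc
    exact hd.1 (le_bot_iff.1 hdc)
  -- By minimality of the value at `x`, removing `c` from it violates one of the defining
  -- inequalities.
  obtain ⟨C', q, hq, hbq⟩ : ∃ (C' : (FinAlg V)ᵒᵖᵒᵖ) (q : C ⟶ C'), G.map q x ∈ E C' ∧
      ¬ b C' (G.map q x) ≤ finForgetHom q (extendVal E b C x \ c) := by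
    by_contra! h
    exact hlt (extendVal_le h)
  -- Passing to the image `R` of `q` loses nothing: closure of `E` under injective maps puts the
  -- image of `x` over `R` in `E`.
  obtain ⟨R, S, r, j, s, m', rfl, hj, hsq, hR⟩ := exists_relativization hV q m
  rw [Functor.map_comp_apply] at hq
  have hx := hE' j hj _ hq
  obtain ⟨β, hβ, hβ'⟩ := hR (b R (G.map r x))
  have hqβ : finForgetHom (r ≫ j) β = b C' (G.map (r ≫ j) x) := by
    rw [finForgetHom_comp, hβ, ← hb _ _ hx, ← Functor.map_comp_apply]
  -- Otherwise minimality of `c` gives `c ≤ βᶜ`; removing `c` then leaves `β` intact, and the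
  -- violated inequality holds after all.
  have hdβ : d ≤ finForgetHom m β := by
    by_contra hdβ
    have h1 : d ≤ finForgetHom m βᶜ := by
      rw [map_compl']
      exact (hd.not_le_iff_disjoint.1 hdβ).le_compl_right
    apply hbq
    rw [sdiff_eq, map_inf, ← hqβ]
    refine le_inf ?_ (OrderHomClass.mono _ (le_compl_comm.1 (hc _ h1)))
    rw [hqβ]
    exact le_map_extendVal _ (by rwa [Functor.map_comp_apply])
  -- The defining inequality at `s` bounds `m' (b R (G.map r x))`, and the choice of `β` as least
  -- lift brings this bound back to `D`.
  have hdy : d ≤ extendVal E b D (G.map m x) := by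
    refine hdβ.trans (hβ' _ ?_)
    rw [← hb _ _ hx, ← Functor.map_comp_apply, ← hsq, Functor.map_comp_apply]
    refine le_map_extendVal _ ?_
    rw [← Functor.map_comp_apply, hsq, Functor.map_comp_apply]
    exact hE _ _ hx
  exact hd.1 (disjoint_self.1 (disjoint_sdiff_self_left.mono hdle hdy))

end Values

/-- An inclusion of presheaves that is closed under injective maps of finite algebras. -/
structure IsClosedInclusion {K G : (FinAlg V)ᵒᵖᵒᵖ ⥤ Type u} (ε : K ⟶ G) : Prop where
  injective : ∀ C, Function.Injective (ε.app C)
  mem_range : ∀ {C D : (FinAlg V)ᵒᵖᵒᵖ} (j : C ⟶ D), Function.Injective (finForgetHom j) →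
    ∀ x, G.map j x ∈ Set.range (ε.app D) → x ∈ Set.range (ε.app C)

namespace IsClosedInclusion

variable {K G : (FinAlg V)ᵒᵖᵒᵖ ⥤ Type u} {ε : K ⟶ G}

open Classical in
/-- The value of a point at the preimage of `x`. -/
noncomputable def preVal (ε : K ⟶ G) (p : K ⟶ finForget V) (C : (FinAlg V)ᵒᵖᵒᵖ) (x : G.obj C) :
    (finForget V).obj C :=
  -- The value `⊥` off the range is never read: `extendVal` consults `b` only on `E`.
  if h : x ∈ Set.range (ε.app C) then p.app C h.choose else ⊥

variable (hε : IsClosedInclusion ε)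
include hε

theorem preVal_app (p : K ⟶ finForget V) (C : (FinAlg V)ᵒᵖᵒᵖ) (x : K.obj C) :
    preVal ε p C (ε.app C x) = p.app C x := by
  have h : ε.app C x ∈ Set.range (ε.app C) := ⟨x, rfl⟩
  rw [preVal, dif_pos h]
  exact congrArg _ (hε.injective C h.choose_spec)

/-- The least extension of a point along a closed inclusion. -/
noncomputable def extend (hV : IsVariety V) (p : K ⟶ finForget V) : G ⟶ finForget V where
  app C := ↾(extendVal (fun C => Set.range (ε.app C)) (preVal ε p) C)
  naturality C D m := by
    ext x
    refine map_extendVal hV ?_ hε.mem_range ?_ m x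
    · rintro C D m _ ⟨x, rfl⟩
      exact ⟨K.map m x, NatTrans.naturality_apply _ _ _⟩
    · rintro C D m _ ⟨x, rfl⟩
      rw [← NatTrans.naturality_apply, hε.preVal_app, hε.preVal_app, NatTrans.naturality_apply,
        finForget_map_apply]

theorem comp_extend (hV : IsVariety V) (p : K ⟶ finForget V) : ε ≫ hε.extend hV p = p := by
  ext C x
  refine (extendVal_of_mem (E := fun C => Set.range (ε.app C)) ?_ ?_
    (Set.mem_range_self x)).trans (hε.preVal_app p C x)
  · rintro C D m _ ⟨x, rfl⟩
    exact ⟨K.map m x, NatTrans.naturality_apply _ _ _⟩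
  · rintro C D m _ ⟨x, rfl⟩
    rw [← NatTrans.naturality_apply, hε.preVal_app, hε.preVal_app, NatTrans.naturality_apply,
      finForget_map_apply]

/-- Extension of points satisfies base change. -/
theorem comp_extend_of_pullback (hV : IsVariety V) {K' G' : (FinAlg V)ᵒᵖᵒᵖ ⥤ Type u} {ε' : K' ⟶ G'}
    (hε' : IsClosedInclusion ε') {α : G ⟶ G'} {κ : K ⟶ K'} (w : ε ≫ α = κ ≫ ε')
    (hα : ∀ C x, α.app C x ∈ Set.range (ε'.app C) → x ∈ Set.range (ε.app C))
    (p : K' ⟶ finForget V) : α ≫ hε'.extend hV p = hε.extend hV (κ ≫ p) := by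
  have hw : ∀ C x, α.app C (ε.app C x) = ε'.app C (κ.app C x) := fun C x =>
    congrArg (fun t => t.app C x) w
  ext C x
  refine (extendVal_app α C x).trans (extendVal_congr (fun C x => ⟨hα C x, ?_⟩) ?_ C x)
  · rintro ⟨x, rfl⟩
    exact ⟨_, (hw C x).symm⟩
  · intro C x hx
    obtain ⟨x, rfl⟩ := hα C x hx
    rw [hε.preVal_app, hw, hε'.preVal_app]
    rfl

end IsClosedInclusion

end Extension

/-! ### Equalizers of presheaves -/

section Equalizers

variable {V : ObjectProperty ModAlg.{u}} {G H : (FinAlg V)ᵒᵖᵒᵖ ⥤ Type u} (f g : G ⟶ H)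

/-- The pointwise equalizer of two maps of presheaves. -/
def eqPresheaf : (FinAlg V)ᵒᵖᵒᵖ ⥤ Type u where
  obj C := {x : G.obj C // f.app C x = g.app C x}
  map m := ↾fun x => ⟨G.map m x.1, by
    rw [NatTrans.naturality_apply, NatTrans.naturality_apply, x.2]⟩

/-- The inclusion of the pointwise equalizer. -/
def eqPresheafι : eqPresheaf f g ⟶ G where
  app C := ↾fun x => x.1

theorem eqPresheafι_condition : eqPresheafι f g ≫ f = eqPresheafι f g ≫ g := by
  ext C x
  exact x.2

/-- The pointwise equalizer is an equalizer. -/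
def eqPresheafIsLimit : IsLimit (Fork.ofι (eqPresheafι f g) (eqPresheafι_condition f g)) :=
  Fork.IsLimit.mk' _ fun s =>
    ⟨{ app := fun C => ↾fun x => ⟨s.ι.app C x, congrArg (fun t => t.app C x) s.condition⟩
       naturality := fun C D m => by
        ext x
        refine Subtype.ext ?_
        exact NatTrans.naturality_apply (F := s.pt) (G := G) s.ι m x }, rfl, fun {m} hm => by
        ext C x
        exact Subtype.ext (congrArg (fun t => t.app C x) hm)⟩

theorem mem_range_eqPresheafι {C : (FinAlg V)ᵒᵖᵒᵖ} {x : G.obj C} :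
    x ∈ Set.range ((eqPresheafι f g).app C) ↔ f.app C x = g.app C x :=
  ⟨fun ⟨y, hy⟩ => hy ▸ y.2, fun h => ⟨⟨x, h⟩, rfl⟩⟩

/-- `H` preserves injectivity of `j`, so the equation `f x = g x` may be tested after applying `j`.
-/
theorem isClosedInclusion_eqPresheafι [IsCofiltered H.Elements] :
    IsClosedInclusion (eqPresheafι f g) where
  injective C x y h := Subtype.ext h
  mem_range j hj x h := by
    rw [mem_range_eqPresheafι] at h ⊢
    apply map_injective_of_isCofiltered H hj
    rwa [← NatTrans.naturality_apply, ← NatTrans.naturality_apply]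

theorem isCofiltered_eqPresheaf (hV : IsVariety V) [IsCofiltered G.Elements]
    [IsCofiltered H.Elements] : IsCofiltered (eqPresheaf f g).Elements := by
  have hε := isClosedInclusion_eqPresheafι f g
  have hlift : ∀ {C : (FinAlg V)ᵒᵖᵒᵖ} (x : G.obj C), f.app C x = g.app C x →
      ∃ y : (eqPresheaf f g).obj C, (eqPresheafι f g).app C y = x := fun x h => ⟨⟨x, h⟩, rfl⟩
  have hmap : ∀ {ι : Type u} [Finite ι] {P : (FinAlg V)ᵒᵖᵒᵖ} {B : ι → (FinAlg V)ᵒᵖᵒᵖ}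
      (p : ∀ i, P ⟶ B i)
      (_ : ∀ x y, (∀ i, finForgetHom (p i) x = finForgetHom (p i) y) → x = y) (x : G.obj P)
      (_ : ∀ i, f.app _ (G.map (p i) x) = g.app _ (G.map (p i) x)),
      f.app P x = g.app P x := by
    intro ι _ P B p hp x h
    refine jointly_injective_of_isCofiltered H p hp fun i => ?_
    rw [← NatTrans.naturality_apply, ← NatTrans.naturality_apply, h]
  obtain ⟨T, p, hp, -, hT⟩ := exists_prod hV (fun i : PEmpty.{u + 1} => i.elim)
  obtain ⟨t, -⟩ := map_prod_surjective G p hT fun i => i.elim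
  obtain ⟨t, -⟩ := hlift t (hmap p hp t fun i => i.elim)
  refine CategoryOfElements.isCofiltered _ T t ?_ ?_
  · intro C D x y
    obtain ⟨P, p, hp, -, hP⟩ := exists_prod hV (fun i : ULift.{u} Bool => if i.down then C else D)
    obtain ⟨z, hz⟩ := map_prod_surjective G p hP
      (fun i => match i with
        | ⟨true⟩ => (eqPresheafι f g).app C x
        | ⟨false⟩ => (eqPresheafι f g).app D y)
    obtain ⟨z, rfl⟩ := hlift z (hmap p hp z <| by
      rintro ⟨_ | _⟩
      · rw [hz ⟨false⟩]
        exact y.2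
      · rw [hz ⟨true⟩]
        exact x.2)
    exact ⟨P, z, p ⟨true⟩, p ⟨false⟩, Subtype.ext (hz ⟨true⟩), Subtype.ext (hz ⟨false⟩)⟩
  · intro C D m m' x h
    obtain ⟨B, z, k, hk, hkm⟩ := exists_equalizing_element G m m' x.1 (congrArg Subtype.val h)
    -- The element `z` need not lie in the equalizer, but its image over `R` does, since the
    -- inclusion is closed; the surjection `r` is then cancelled from the equation.
    obtain ⟨R, r, j, rfl, hr, hj⟩ := exists_image hV k
    rw [Functor.map_comp_apply] at hk
    obtain ⟨y, hy⟩ := hε.mem_range j hj (G.map r z) (hk ▸ ⟨x, rfl⟩)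
    refine ⟨R, y, j, Subtype.ext ?_, finAlg_cancel_surjective hr (by simpa using hkm)⟩
    rw [← hk, ← hy]
    rfl

theorem isClosedInclusion_of_retraction [IsCofiltered H.Elements] {f : G ⟶ H} {r : H ⟶ G}
    (h : f ≫ r = 𝟙 G) : IsClosedInclusion f := by
  have hfr : ∀ C x, r.app C (f.app C x) = x := fun C x => congrArg (fun t => t.app C x) h
  refine ⟨fun C => Function.LeftInverse.injective (hfr C), ?_⟩
  rintro C D j hj y ⟨x, hx⟩
  refine ⟨r.app C y, map_injective_of_isCofiltered H hj ?_⟩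
  rw [← NatTrans.naturality_apply, ← NatTrans.naturality_apply, ← hx, hfr]

end Equalizers

/-! ### Reduced elements -/

section Reduced

variable {V : ObjectProperty ModAlg.{u}}

/-- An element of a presheaf is reduced if it does not come from a proper subalgebra. -/
def IsReducedElement (G : (FinAlg V)ᵒᵖᵒᵖ ⥤ Type u) {B : (FinAlg V)ᵒᵖᵒᵖ} (z : G.obj B) : Prop :=
  ∀ (W : (FinAlg V)ᵒᵖᵒᵖ) (w : G.obj W) (k : W ⟶ B), G.map k w = z →
    Function.Surjective (finForgetHom k)

theorem exists_isReducedElement (hV : IsVariety V) (G : (FinAlg V)ᵒᵖᵒᵖ ⥤ Type u)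
    {C : (FinAlg V)ᵒᵖᵒᵖ} (x : G.obj C) :
    ∃ (B : (FinAlg V)ᵒᵖᵒᵖ) (z : G.obj B) (k : B ⟶ C), G.map k z = x ∧ IsReducedElement G z := by
  induction hn : Nat.card ((finForget V).obj C) using Nat.strong_induction_on generalizing C with
  | _ n ih =>
    by_cases hx : IsReducedElement G x
    · exact ⟨C, x, 𝟙 C, by simp, hx⟩
    · simp only [IsReducedElement, not_forall] at hx
      obtain ⟨W, w, k, rfl, hk⟩ := hx
      obtain ⟨R, r, j, rfl, hr, hj⟩ := exists_image hV k
      have hlt : Nat.card ((finForget V).obj R) < n := by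
        refine hn ▸ lt_of_le_of_ne (Nat.card_le_card_of_injective _ hj) fun h => hk ?_
        exact (hj.bijective_of_nat_card_le h.ge).2.comp hr
      obtain ⟨B, z, l, hl, hz⟩ := ih _ hlt (G.map r w) rfl
      exact ⟨B, z, l ≫ j, by simp [hl], hz⟩

variable {G : (FinAlg V)ᵒᵖᵒᵖ ⥤ Type u} [IsCofiltered G.Elements]

/-- Dually, a reduced element is the inclusion of a finite generated subframe. Two maps agreeing on
`z` are equalized by a map through which `z` lifts; reducedness makes it surjective, so they
coincide. -/
theorem IsReducedElement.isClosedInclusion {B : (FinAlg V)ᵒᵖᵒᵖ} {z : G.obj B}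
    (hz : IsReducedElement G z) :
    IsClosedInclusion (coyonedaEquiv.symm z : coyoneda.obj (op B) ⟶ G) where
  injective C := by
    intro (m : B ⟶ C) (m' : B ⟶ C) (h : G.map m z = G.map m' z)
    obtain ⟨W, w, e, he, h⟩ := exists_equalizing_element G m m' z h
    exact finAlg_cancel_surjective (hz W w e he) h
  mem_range {C D} j hj x := by
    rintro ⟨m : B ⟶ D, hm : G.map m z = G.map j x⟩
    obtain ⟨W, w, k, l, rfl, rfl⟩ := exists_common_element G x z
    obtain ⟨W', w, e, rfl, he⟩ := exists_equalizing_element G (l ≫ m) (k ≫ j) w (by simpa using hm)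
    -- As `e ≫ l` is onto, the image of `m` is that of `e ≫ l ≫ m = e ≫ k ≫ j`, hence lies in the
    -- image of `j`.
    have hs := hz W' w (e ≫ l) (by simp)
    obtain ⟨m, rfl⟩ := exists_factor hj m fun b => by
      obtain ⟨a, rfl⟩ := hs b
      refine ⟨finForgetHom (e ≫ k) a, ?_⟩
      rw [← finForgetHom_comp, ← finForgetHom_comp, Category.assoc, Category.assoc, he]
    refine ⟨m, map_injective_of_isCofiltered G hj ?_⟩
    change G.map j (G.map m (G.map l (G.map e w))) = _
    rw [← Functor.map_comp_apply, hm]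

/-- By Yoneda `b` is a point of the functor represented by `B`, and it extends along the closed
inclusion given by `z`. -/
theorem IsReducedElement.exists_point (hV : IsVariety V) {B : (FinAlg V)ᵒᵖᵒᵖ} {z : G.obj B}
    (hz : IsReducedElement G z) (b : (finForget V).obj B) :
    ∃ a : G ⟶ finForget V, a.app B z = b := by
  refine ⟨hz.isClosedInclusion.extend hV (coyonedaEquiv.symm b), ?_⟩
  have h := congrArg (fun t => t.app B (𝟙 B))
    (hz.isClosedInclusion.comp_extend hV (coyonedaEquiv.symm b))
  simpa using h

/-- The points of a presheaf separate its elements. -/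
theorem eq_of_forall_point (hV : IsVariety V) {C : (FinAlg V)ᵒᵖᵒᵖ} {x y : G.obj C}
    (h : ∀ a : G ⟶ finForget V, a.app C x = a.app C y) : x = y := by
  obtain ⟨W, w, k, l, rfl, rfl⟩ := exists_common_element G x y
  obtain ⟨B, z, e, rfl, hz⟩ := exists_isReducedElement hV G w
  have : e ≫ k = e ≫ l := finAlg_hom_ext fun b => by
    obtain ⟨a, rfl⟩ := hz.exists_point hV b
    have := h a
    rw [← Functor.map_comp_apply, ← Functor.map_comp_apply] at this
    rwa [NatTrans.naturality_apply, NatTrans.naturality_apply] at this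
  rw [← Functor.map_comp_apply, ← Functor.map_comp_apply, this]

end Reduced

/-! ### Maps that are bijective on points -/

section Isomorphisms

variable {V : ObjectProperty ModAlg.{u}} {G H : (FinAlg V)ᵒᵖᵒᵖ ⥤ Type u} [IsCofiltered G.Elements]
  [IsCofiltered H.Elements] {φ : G ⟶ H}

omit [IsCofiltered H.Elements] in
theorem app_injective_of_surjective_on_points (hV : IsVariety V)
    (hφ : Function.Surjective fun a : H ⟶ finForget V => φ ≫ a) (C : (FinAlg V)ᵒᵖᵒᵖ) :
    Function.Injective (φ.app C) := fun x y h => eq_of_forall_point hV fun a => by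
  obtain ⟨a, rfl⟩ := hφ a
  exact congrArg (a.app C) h

theorem isClosedInclusion_of_surjective_on_points (hV : IsVariety V)
    (hφ : Function.Surjective fun a : H ⟶ finForget V => φ ≫ a) : IsClosedInclusion φ where
  injective := app_injective_of_surjective_on_points hV hφ
  mem_range j hj y := by
    rintro ⟨x, hx⟩
    obtain ⟨B, z, k, rfl, hz⟩ := exists_isReducedElement hV G x
    -- Every `b` is the value at `z` of a point of `G`; that point comes from `H`, and its value at
    -- `w` is a preimage of `b`.
    have hz' : IsReducedElement H (φ.app B z) := fun W w k hk b => by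
      obtain ⟨a, rfl⟩ := hz.exists_point hV b
      obtain ⟨a, rfl⟩ := hφ a
      refine ⟨a.app W w, ?_⟩
      rw [← finForget_map_apply, ← NatTrans.naturality_apply, hk]
      rfl
    rw [NatTrans.naturality_apply] at hx
    obtain ⟨m, rfl⟩ := hz'.isClosedInclusion.mem_range j hj y ⟨k, hx⟩
    exact ⟨G.map m z, NatTrans.naturality_apply _ _ _⟩

/-- The greatest point of a presheaf. -/
def topPoint (G : (FinAlg V)ᵒᵖᵒᵖ ⥤ Type u) : G ⟶ finForget V where
  app C := ↾fun _ => (⊤ : (finForget V).obj C)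
  naturality C D m := by
    ext x
    exact (map_top (finForgetHom m)).symm

theorem app_bijective_of_bijective_on_points (hV : IsVariety V)
    (hφ : Function.Bijective fun a : H ⟶ finForget V => φ ≫ a) (C : (FinAlg V)ᵒᵖᵒᵖ) :
    Function.Bijective (φ.app C) := by
  have hc := isClosedInclusion_of_surjective_on_points hV hφ.2
  refine ⟨hc.injective C, fun y => ?_⟩
  have htop : hc.extend hV (topPoint G) = topPoint H := hφ.1 (hc.comp_extend hV (topPoint G))
  have hy : extendVal (fun C => Set.range (φ.app C)) (IsClosedInclusion.preVal φ (topPoint G)) C y =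
      ⊤ := congrArg (fun t => t.app C y) htop
  -- If every such `q` killed `c`, then `cᶜ` would satisfy all inequalities defining the value at
  -- `y`, which is `⊤`; so `c` would be `⊥`.
  have hex : ∀ c : {c : (finForget V).obj C // c ≠ ⊥}, ∃ (D : (FinAlg V)ᵒᵖᵒᵖ) (q : C ⟶ D),
      H.map q y ∈ Set.range (φ.app D) ∧ finForgetHom q c ≠ ⊥ := by
    rintro ⟨c, hc⟩
    by_contra! h
    refine hc (compl_eq_top.1 (top_le_iff.1 (hy.ge.trans (extendVal_le fun D q hq => ?_))))
    rw [map_compl', h D q hq, compl_bot]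
    exact le_top
  choose D q hq hqc using hex
  choose x hx using hq
  -- Together these maps embed `C` in a finite product over which the image of `y` lies in the
  -- range, so closedness of the range applies.
  obtain ⟨P, p, hp, -, hP⟩ := exists_prod hV D
  obtain ⟨x, hx'⟩ := map_prod_surjective G p hP x
  obtain ⟨q, rfl⟩ : ∃ q' : C ⟶ P, q = fun c => q' ≫ p c := by
    obtain ⟨q', h⟩ := hP C q
    exact ⟨q', funext fun c => (h c).symm⟩
  refine hc.mem_range q ?_ y ⟨x, jointly_injective_of_isCofiltered H p hp fun c => ?_⟩
  · intro a b hab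
    by_contra hne
    refine hqc ⟨symmDiff a b, fun h => hne (symmDiff_eq_bot.1 h)⟩ ?_
    rw [finForgetHom_comp, map_symmDiff', hab, symmDiff_self, map_bot]
  · rw [← NatTrans.naturality_apply, hx', hx, Functor.map_comp_apply]

end Isomorphisms

/-! ### Transport of structure -/

/-- Transport of a modal algebra structure along a bijection. -/
abbrev Equiv.modalAlgebra {α β : Type*} [ModalAlgebra β] (e : α ≃ β) : ModalAlgebra α :=
  ModalAlgebra.ofInjective (e.symm ⊥) (fun a b => e.symm (e a ⊔ e b)) (fun a => e.symm (e a)ᶜ)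
    (fun a => e.symm (ModalAlgebra.dia (e a))) e e.injective (by simp) (by simp) (by simp) (by simp)

/-- The isomorphism along which a modal algebra structure is transported. -/
def Equiv.modalHom {α β : Type*} [ModalAlgebra β] (e : α ≃ β) :
    letI := e.modalAlgebra
    ModalHom α β :=
  letI := e.modalAlgebra
  ModalHom.ofPreserves e (e.apply_symm_apply _) (fun _ _ => e.apply_symm_apply _)
    (fun _ => e.apply_symm_apply _) (fun _ => e.apply_symm_apply _)

/-! ### Ind-objects over the opposite of the category of finite algebras -/

section IndObjects

variable {V : ObjectProperty ModAlg.{u}}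

theorem CategoryTheory.Limits.IsIndObject.isCofiltered_elements {C : Type*} [Category.{u} C]
    {G : Cᵒᵖ ⥤ Type u} (h : IsIndObject G) : IsCofiltered G.Elements :=
  have := h.isFiltered
  have : IsFiltered G.Elementsᵒᵖ :=
    IsFiltered.of_equivalence (CategoryOfElements.costructuredArrowYonedaEquivalence G).symm
  isCofiltered_of_isFiltered_op _

instance (K : Ind (FinAlg V)ᵒᵖ) :
    IsCofiltered ((Ind.inclusion (FinAlg V)ᵒᵖ).obj K).Elements :=
  K.isIndObject_inclusion_obj.isCofiltered_elements

theorem isIndObject_of_isCofiltered_elements (hV : IsVariety V) (G : (FinAlg V)ᵒᵖᵒᵖ ⥤ Type u)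
    [IsCofiltered G.Elements] : IsIndObject G := by
  have : IsFiltered (CostructuredArrow yoneda G) :=
    IsFiltered.of_equivalence (CategoryOfElements.costructuredArrowYonedaEquivalence G)
  -- Every finite algebra is isomorphic to one on `ULift (Fin n)`; these algebras with their
  -- elements of `G` form a small weakly terminal set.
  have : FinallySmall.{u} (CostructuredArrow yoneda G) := by
    let T := Σ (n : ℕ) (_ : ModalAlgebra (ULift.{u} (Fin n)))
      (h : PLift (V (ModAlg.of (ULift.{u} (Fin n))))), G.obj (finAlgOf (ULift.{u} (Fin n)) h.down)
    let t : T → CostructuredArrow yoneda G := fun x =>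
      (CategoryOfElements.costructuredArrowYonedaEquivalence G).functor.obj
        (op ⟨_, x.2.2.2⟩)
    refine finallySmall_of_small_weakly_terminal_set (Set.range t) fun j => ?_
    let e := CategoryOfElements.costructuredArrowYonedaEquivalence G
    obtain ⟨⟨D, x⟩, hj⟩ : ∃ y : G.Elements, y = (e.functor.objPreimage j).unop := ⟨_, rfl⟩
    let ε : ULift.{u} (Fin (Nat.card ((finForget V).obj D))) ≃ (finForget V).obj D :=
      Equiv.ulift.trans (Finite.equivFin _).symm
    let : ModalAlgebra (ULift.{u} (Fin (Nat.card ((finForget V).obj D)))) := ε.modalAlgebra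
    let B : (FinAlg V)ᵒᵖᵒᵖ := finAlgOf (ULift.{u} (Fin (Nat.card ((finForget V).obj D))))
      (hV.of_injective ε.modalHom ε.injective (finForget_mem D))
    let k : B ⟶ D := finAlgHom (C := B) ε.modalHom
    let l : D ⟶ B := finAlgHom (D := B) (ε.modalHom.symm ε fun _ => rfl)
    have hlk : l ≫ k = 𝟙 D := finAlg_hom_ext fun d => ε.apply_symm_apply d
    have hx : G.map k (G.map l x) = x := by
      rw [← Functor.map_comp_apply, hlk, Functor.map_id_apply]
    let y : G.Elements := ⟨B, G.map l x⟩
    let m : y ⟶ (e.functor.objPreimage j).unop :=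
      CategoryOfElements.homMk y ⟨D, x⟩ k hx ≫ eqToHom hj
    exact ⟨_, ⟨⟨_, ε.modalAlgebra, ⟨B.unop.unop.property.1⟩, G.map l x⟩, rfl⟩,
      ⟨(e.functor.objObjPreimageIso j).inv ≫ e.functor.map m.op⟩⟩
  exact isIndObject_of_isFiltered_of_finallySmall G

/-- An ind-object with a given presheaf. -/
noncomputable def indOf (G : (FinAlg V)ᵒᵖᵒᵖ ⥤ Type u) (h : IsIndObject G) : Ind (FinAlg V)ᵒᵖ :=
  (Ind.equivalence _).inverse.obj ⟨G, h⟩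

/-- The presheaf of `indOf G h` is `G`. -/
noncomputable def indOfIso (G : (FinAlg V)ᵒᵖᵒᵖ ⥤ Type u) (h : IsIndObject G) :
    (Ind.inclusion (FinAlg V)ᵒᵖ).obj (indOf G h) ≅ G :=
  (ObjectProperty.ι _).mapIso ((Ind.equivalence (FinAlg V)ᵒᵖ).counitIso.app ⟨G, h⟩)

end IndObjects

/-! ### The left adjoint of the forgetful functor -/

section LeftAdjoint

variable (V : ObjectProperty ModAlg.{u})

/-- The presheaf of maps from a set to finite algebras. -/
def powPresheaf (X : Type u) : (FinAlg V)ᵒᵖᵒᵖ ⥤ Type u where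
  obj C := X → (finForget V).obj C
  map m := ↾fun v x => (finForget V).map m (v x)

/-- The points of the presheaf of maps from `X` given by the elements of `X`. -/
def powEval (X : Type u) (x : X) : powPresheaf V X ⟶ finForget V where
  app C := ↾fun v => v x

variable {V}

theorem isCofiltered_powPresheaf (hV : IsVariety V) (X : Type u) :
    IsCofiltered (powPresheaf V X).Elements := by
  obtain ⟨T, p, -, hT, -⟩ := exists_prod hV (fun i : PEmpty.{u + 1} => i.elim)
  obtain ⟨t, -⟩ := hT fun i => i.elim
  refine CategoryOfElements.isCofiltered _ T (fun _ => t) ?_ ?_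
  · intro C D x y
    obtain ⟨P, p, -, hP, -⟩ := exists_prod hV (fun i : ULift.{u} Bool => if i.down then C else D)
    choose z hz using fun a : X => hP (fun i => match i with
      | ⟨true⟩ => x a
      | ⟨false⟩ => y a)
    exact ⟨P, z, p ⟨true⟩, p ⟨false⟩, funext fun a => hz a ⟨true⟩, funext fun a => hz a ⟨false⟩⟩
  · intro C D f g x h
    obtain ⟨B, j, hj, -, hB⟩ := exists_equalizer hV f g
    choose z hz using fun a : X => hB (x a) (congrFun h a)
    exact ⟨B, z, j, funext hz, hj⟩

/-- Maps to the presheaf of maps from `X` are families of points indexed by `X`. -/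
def powHomEquiv (X : Type u) (G : (FinAlg V)ᵒᵖᵒᵖ ⥤ Type u) :
    (G ⟶ powPresheaf V X) ≃ (X → (G ⟶ finForget V)) where
  toFun t x := t ≫ powEval V X x
  invFun p :=
    { app := fun C => ↾fun y x => (p x).app C y
      naturality := fun C D m => by
        ext y
        exact funext fun x => NatTrans.naturality_apply (p x) m y }
  left_inv _ := rfl
  right_inv _ := rfl

variable (hV : IsVariety V)

/-- The free pro-object on a set. -/
noncomputable def freePro (X : Type u) : ProCat (FinAlg V) :=
  have := isCofiltered_powPresheaf hV X
  op (indOf (powPresheaf V X) (isIndObject_of_isCofiltered_elements hV _))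

/-- The presheaf of the free pro-object on a set. -/
noncomputable def freeProIso (X : Type u) :
    (Ind.inclusion (FinAlg V)ᵒᵖ).obj (freePro hV X).unop ≅ powPresheaf V X :=
  indOfIso _ _

/-- The points of the free pro-object given by the generators. -/
noncomputable def freePoint (X : Type u) (x : X) : ProPoint (freePro hV X) :=
  (freeProIso hV X).hom ≫ powEval V X x

/-- The universal property of the free pro-object. -/
noncomputable def freeProHomEquiv (X : Type u) (P : ProCat (FinAlg V)) :
    (freePro hV X ⟶ P) ≃ (X ⟶ (proForget V).obj P) :=
  (opEquiv (freePro hV X) P).trans <| Ind.inclusion.fullyFaithful.homEquiv.trans <|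
    ((Iso.refl _).homCongr (freeProIso hV X)).trans <| (powHomEquiv X _).trans <|
    (Equiv.arrowCongr (Equiv.refl X) (equivShrink (ProPoint P))).trans
      ⟨fun f => ↾f, fun f => f, fun _ => rfl, fun _ => rfl⟩

theorem freeProHomEquiv_apply {X : Type u} {P : ProCat (FinAlg V)} (f : freePro hV X ⟶ P) (x : X) :
    freeProHomEquiv hV X P f x =
      equivShrink _ ((Ind.inclusion (FinAlg V)ᵒᵖ).map f.unop ≫ freePoint hV X x) := by
  change equivShrink _ ((𝟙 _ ≫ (Ind.inclusion (FinAlg V)ᵒᵖ).map f.unop ≫ (freeProIso hV X).hom) ≫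
    powEval V X x) = _
  rw [Category.id_comp, Category.assoc]
  rfl

theorem proForget_map_equivShrink {P Q : ProCat (FinAlg V)} (f : P ⟶ Q) (p : ProPoint P) :
    (proForget V).map f (equivShrink (ProPoint P) p) =
      equivShrink (ProPoint Q) ((Ind.inclusion (FinAlg V)ᵒᵖ).map f.unop ≫ p) := by
  change equivShrink _ (_ ≫ (equivShrink _).symm (equivShrink _ p)) = _
  rw [Equiv.symm_apply_apply]

/-- The left adjoint of the forgetful functor. -/
noncomputable def freeProFunctor : Type u ⥤ ProCat (FinAlg V) :=
  Adjunction.leftAdjointOfEquiv (G := proForget V) (freeProHomEquiv hV) fun X P Q g h => by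
    ext x
    refine (freeProHomEquiv_apply hV _ x).trans (Eq.trans ?_
      (congrArg ((proForget V).map g) (freeProHomEquiv_apply hV h x)).symm)
    rw [proForget_map_equivShrink, unop_comp, Functor.map_comp, Category.assoc]

/-- The adjunction between `freeProFunctor` and the forgetful functor. -/
noncomputable def freeProAdj : freeProFunctor hV ⊣ proForget V :=
  Adjunction.adjunctionOfEquivLeft _ _

theorem freeProAdj_homEquiv {X : Type u} {P : ProCat (FinAlg V)}
    (f : (freeProFunctor hV).obj X ⟶ P) :
    (freeProAdj hV).homEquiv X P f = freeProHomEquiv hV X P f :=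
  Equiv.congr_fun (congrFun₂ (Adjunction.mkOfHomEquiv_homEquiv _) X P) f

end LeftAdjoint

/-! ### Monadicity -/

section Monadicity

variable {V : ObjectProperty ModAlg.{u}} (hV : IsVariety V)

/-- The map of underlying sets of pro-objects given by a map of points. -/
noncomputable def pointMap {P Q : ProCat (FinAlg V)} (t : ProPoint P → ProPoint Q) :
    (proForget V).obj P ⟶ (proForget V).obj Q :=
  ↾fun a => equivShrink (ProPoint Q) (t ((equivShrink (ProPoint P)).symm a))

theorem pointMap_comp {P Q R : ProCat (FinAlg V)} (t : ProPoint P → ProPoint Q)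
    (t' : ProPoint Q → ProPoint R) : pointMap t ≫ pointMap t' = pointMap fun p => t' (t p) := by
  ext a
  exact congrArg (fun p => equivShrink (ProPoint R) (t' p)) (Equiv.symm_apply_apply _ _)

theorem pointMap_id (P : ProCat (FinAlg V)) :
    pointMap (fun p : ProPoint P => p) = 𝟙 ((proForget V).obj P) := by
  ext a
  exact Equiv.apply_symm_apply (equivShrink (ProPoint P)) a

theorem proForget_map_eq {P Q : ProCat (FinAlg V)} (f : P ⟶ Q) :
    (proForget V).map f = pointMap fun p => (Ind.inclusion (FinAlg V)ᵒᵖ).map f.unop ≫ p :=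
  rfl

include hV

theorem proForget_reflectsIsomorphisms : (proForget V).ReflectsIsomorphisms where
  reflects {P Q} f hf := by
    have hb : Function.Bijective fun p : ProPoint P =>
        (Ind.inclusion (FinAlg V)ᵒᵖ).map f.unop ≫ p := by
      have h := (isIso_iff_bijective _).1 hf
      have : (fun p : ProPoint P => (Ind.inclusion (FinAlg V)ᵒᵖ).map f.unop ≫ p) =
          (equivShrink _).symm ∘ (proForget V).map f ∘ equivShrink _ := by
        funext p
        exact ((Equiv.symm_apply_eq _).2 (proForget_map_equivShrink f p)).symm
      rw [this]
      exact (Equiv.bijective _).comp (h.comp (Equiv.bijective _))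
    have : ∀ C, IsIso (((Ind.inclusion (FinAlg V)ᵒᵖ).map f.unop).app C) := fun C =>
      (isIso_iff_bijective _).2 (app_bijective_of_bijective_on_points hV hb C)
    have := NatIso.isIso_of_isIso_app ((Ind.inclusion (FinAlg V)ᵒᵖ).map f.unop)
    have := isIso_of_reflects_iso f.unop (Ind.inclusion (FinAlg V)ᵒᵖ)
    exact (isIso_unop_iff f).1 this

/-- Passing to opposites, this is the pointwise equalizer, which is again an ind-object. The
isomorphism `α` is recorded so that points of the coequalizer can be extended explicitly. -/
theorem exists_coequalizer {P Q : ProCat (FinAlg V)} (f g : P ⟶ Q) :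
    ∃ (K : ProCat (FinAlg V)) (k : Q ⟶ K) (w : f ≫ k = g ≫ k)
      (_ : IsColimit (Cofork.ofπ k w))
      (α : (Ind.inclusion (FinAlg V)ᵒᵖ).obj K.unop ≅ eqPresheaf
        ((Ind.inclusion (FinAlg V)ᵒᵖ).map f.unop) ((Ind.inclusion (FinAlg V)ᵒᵖ).map g.unop)),
      (Ind.inclusion (FinAlg V)ᵒᵖ).map k.unop = α.hom ≫ eqPresheafι _ _ := by
  let I := Ind.inclusion (FinAlg V)ᵒᵖ
  have := isCofiltered_eqPresheaf (I.map f.unop) (I.map g.unop) hV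
  let K := indOf _ (isIndObject_of_isCofiltered_elements hV
    (eqPresheaf (I.map f.unop) (I.map g.unop)))
  let α : I.obj K ≅ eqPresheaf (I.map f.unop) (I.map g.unop) := indOfIso _ _
  let k : K ⟶ Q.unop := I.preimage (α.hom ≫ eqPresheafι _ _)
  have hk : I.map k = α.hom ≫ eqPresheafι _ _ := I.map_preimage _
  have w : f ≫ k.op = g ≫ k.op := Quiver.Hom.unop_inj <| I.map_injective <| by
    rw [unop_comp, unop_comp, Quiver.Hom.unop_op, I.map_comp, I.map_comp, hk, Category.assoc,
      Category.assoc, eqPresheafι_condition]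
  refine ⟨op K, k.op, w, ?_, α, hk⟩
  refine Cofork.IsColimit.mk' _ fun s => ?_
  have hs : I.map s.π.unop ≫ I.map f.unop = I.map s.π.unop ≫ I.map g.unop := by
    rw [← I.map_comp, ← I.map_comp, ← unop_comp, s.condition, unop_comp]
  obtain ⟨l, hl⟩ := Fork.IsLimit.lift' (eqPresheafIsLimit (I.map f.unop) (I.map g.unop)) _ hs
  change l ≫ eqPresheafι _ _ = _ at hl
  refine ⟨(I.preimage (l ≫ α.inv)).op, ?_, fun {m} hm => ?_⟩
  · refine Quiver.Hom.unop_inj (I.map_injective ?_)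
    change I.map (I.preimage (l ≫ α.inv) ≫ k) = _
    rw [I.map_comp, I.map_preimage, hk, Category.assoc, α.inv_hom_id_assoc, hl]
  · refine Quiver.Hom.unop_inj (I.map_injective ?_)
    rw [Quiver.Hom.unop_op, I.map_preimage, Iso.eq_comp_inv]
    refine Fork.IsLimit.hom_ext (eqPresheafIsLimit (I.map f.unop) (I.map g.unop)) ?_
    change (I.map m.unop ≫ α.hom) ≫ eqPresheafι _ _ = l ≫ eqPresheafι _ _
    rw [hl, Category.assoc, ← hk, ← I.map_comp, ← hm]
    rfl

theorem proForget_hasReflexiveCoequalizers : HasReflexiveCoequalizers (ProCat (FinAlg V)) where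
  has_coeq _ _ f g _ := by
    obtain ⟨K, k, w, h, -⟩ := exists_coequalizer hV f g
    exact ⟨⟨⟨_, h⟩⟩⟩

theorem proForget_isSplitCoequalizer {P Q K : ProCat (FinAlg V)} (f g : P ⟶ Q) [IsReflexivePair f g]
    (k : Q ⟶ K) (w : f ≫ k = g ≫ k)
    (α : (Ind.inclusion (FinAlg V)ᵒᵖ).obj K.unop ≅ eqPresheaf
        ((Ind.inclusion (FinAlg V)ᵒᵖ).map f.unop) ((Ind.inclusion (FinAlg V)ᵒᵖ).map g.unop))
    (hk : (Ind.inclusion (FinAlg V)ᵒᵖ).map k.unop = α.hom ≫ eqPresheafι _ _) :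
    Nonempty (IsSplitCoequalizer ((proForget V).map f) ((proForget V).map g)
      ((proForget V).map k)) := by
  let I := Ind.inclusion (FinAlg V)ᵒᵖ
  obtain ⟨s, hf, hg⟩ := IsReflexivePair.common_section f g
  have hf' : I.map f.unop ≫ I.map s.unop = 𝟙 _ := by
    rw [← I.map_comp, ← unop_comp, hf, unop_id, I.map_id]
  have hg' : I.map g.unop ≫ I.map s.unop = 𝟙 _ := by
    rw [← I.map_comp, ← unop_comp, hg, unop_id, I.map_id]
  have hfs : ∀ C x, (I.map s.unop).app C ((I.map f.unop).app C x) = x := fun C x =>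
    congrArg (fun t => t.app C x) hf'
  have hgs : ∀ C x, (I.map s.unop).app C ((I.map g.unop).app C x) = x := fun C x =>
    congrArg (fun t => t.app C x) hg'
  have hε : IsClosedInclusion (eqPresheafι (I.map f.unop) (I.map g.unop)) :=
    isClosedInclusion_eqPresheafι _ _
  have hγ : IsClosedInclusion (I.map g.unop) := isClosedInclusion_of_retraction hg'
  -- The equalizer is also the pullback of the two maps: if `f x = g y`, the common retraction gives
  -- `x = y`. Base change for this square is the equation `leftSection_top`.
  have base := fun p : ProPoint Q => hε.comp_extend_of_pullback hV hγ (α := I.map f.unop)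
    (eqPresheafι_condition _ _) (by
      rintro C x ⟨y, hy⟩
      have hxy : y = x := by rw [← hgs C y, hy, hfs]
      rw [mem_range_eqPresheafι, ← hxy, hy, hxy]) p
  refine ⟨{
    rightSection := pointMap fun p : ProPoint K => hε.extend hV (α.inv ≫ p)
    leftSection := pointMap fun p : ProPoint Q => hγ.extend hV p
    condition := by rw [← Functor.map_comp, w, Functor.map_comp]
    rightSection_π := ?_
    leftSection_bottom := ?_
    leftSection_top := ?_ }⟩
  · rw [proForget_map_eq, pointMap_comp, ← pointMap_id]
    refine congrArg _ (funext fun p => ?_)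
    rw [hk, Category.assoc, hε.comp_extend, α.hom_inv_id_assoc]
  · rw [proForget_map_eq, pointMap_comp, ← pointMap_id]
    exact congrArg _ (funext fun p => hγ.comp_extend hV p)
  · rw [proForget_map_eq, proForget_map_eq, pointMap_comp, pointMap_comp]
    refine congrArg _ (funext fun p => ?_)
    rw [hk, Category.assoc, α.inv_hom_id_assoc]
    exact base p

theorem proForget_preservesReflexiveCoequalizers :
    Monad.PreservesColimitOfIsReflexivePair (proForget V) where
  out _ _ f g _ := by
    obtain ⟨K, k, w, h, α, hk⟩ := exists_coequalizer hV f g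
    obtain ⟨t⟩ := proForget_isSplitCoequalizer hV f g k w α hk
    exact preservesColimit_of_preserves_colimit_cocone h
      ((isColimitMapCoconeCoforkEquiv _ w).symm t.isCoequalizer)

/-- The forgetful functor is monadic. -/
theorem proForget_monadic : Nonempty (MonadicRightAdjoint (proForget V)) :=
  have := proForget_reflectsIsomorphisms hV
  have := proForget_hasReflexiveCoequalizers hV
  have := proForget_preservesReflexiveCoequalizers hV
  ⟨Monad.monadicOfHasPreservesReflexiveCoequalizersOfReflectsIsomorphisms (freeProAdj hV)⟩

end Monadicity

/-! ### Limits of modal algebras -/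

section Limits

/-- A cone of modal algebras whose projections are jointly injective, and jointly surjective onto
compatible families, is a limit cone. -/
theorem ModAlg.nonempty_isLimit {J : Type*} [Category* J] {F : J ⥤ ModAlg.{u}} (c : Cone F)
    (hinj : ∀ x y : c.pt, (∀ j, c.π.app j x = c.π.app j y) → x = y)
    (hex : ∀ s : ∀ j, F.obj j, (∀ {j k : J} (f : j ⟶ k), F.map f (s j) = s k) →
      ∃ x : c.pt, ∀ j, c.π.app j x = s j) : Nonempty (IsLimit c) := by
  have h : ∀ (s : Cone F) (a : s.pt), ∃ x : c.pt, ∀ j, c.π.app j x = s.π.app j a := fun s a =>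
    hex (fun j => s.π.app j a) fun {j k} f => by
      rw [← s.w f]
      rfl
  choose l hl using h
  let γ : ∀ j, ModalHom c.pt (F.obj j) := fun j => (c.π.app j).hom'
  let σ : ∀ (s : Cone F) (j : J), ModalHom s.pt (F.obj j) := fun s j => (s.π.app j).hom'
  have hγ : ∀ s a j, γ j (l s a) = σ s j a := hl
  have hinj' : ∀ x y : c.pt, (∀ j, γ j x = γ j y) → x = y := hinj
  refine ⟨{
    lift := fun s => ⟨ModalHom.ofPreserves (l s) (hinj' _ _ fun j => ?_)
      (fun a b => hinj' _ _ fun j => ?_) (fun a => hinj' _ _ fun j => ?_)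
      (fun a => hinj' _ _ fun j => ?_)⟩
    fac := fun s j => ModAlg.Hom.ext (ModalHom.ext fun a => hl s a j)
    uniq := fun s m hm => ModAlg.Hom.ext (ModalHom.ext fun a => hinj' _ _ fun j => ?_) }⟩
  · rw [hγ, map_bot, map_bot]
  · rw [hγ, map_sup, map_sup, hγ, hγ]
  · rw [hγ, map_compl', map_compl', hγ]
  · rw [hγ, ModalHom.map_dia, ModalHom.map_dia, hγ]
  · refine Eq.trans ?_ (hl s a j).symm
    rw [← hm j]
    rfl

end Limits

/-! ### Maps from pro-objects to finite algebras -/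

section Elements

variable {V : ObjectProperty ModAlg.{u}}

/-- The presheaf of (the pro-object given by) a finite algebra is representable. -/
noncomputable def yonedaIsoProEmb (C : FinAlg V) :
    yoneda.obj (op C) ≅ (Ind.inclusion (FinAlg V)ᵒᵖ).obj ((proEmb (FinAlg V)).obj C).unop :=
  ((Ind.yonedaCompInclusion (C := (FinAlg V)ᵒᵖ)).app (op C)).symm

theorem yonedaIsoProEmb_naturality {C D : FinAlg V} (f : C ⟶ D) :
    yoneda.map f.op ≫ (yonedaIsoProEmb C).hom = (yonedaIsoProEmb D).hom ≫
      (Ind.inclusion (FinAlg V)ᵒᵖ).map ((proEmb (FinAlg V)).map f).unop :=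
  (Ind.yonedaCompInclusion (C := (FinAlg V)ᵒᵖ)).inv.naturality f.op

/-- Maps from a pro-object to a finite algebra are elements of its presheaf. -/
noncomputable def proElem (P : ProCat (FinAlg V)) (C : FinAlg V) :
    (P ⟶ (proEmb (FinAlg V)).obj C) ≃
      ((Ind.inclusion (FinAlg V)ᵒᵖ).obj P.unop).obj (op (op C)) :=
  (opEquiv P _).trans <| Ind.inclusion.fullyFaithful.homEquiv.trans <|
    ((yonedaIsoProEmb C).symm.homCongr (Iso.refl _)).trans yonedaEquiv

theorem proElem_eq {P : ProCat (FinAlg V)} {C : FinAlg V} (k : P ⟶ (proEmb (FinAlg V)).obj C) :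
    proElem P C k =
      yonedaEquiv ((yonedaIsoProEmb C).hom ≫ (Ind.inclusion (FinAlg V)ᵒᵖ).map k.unop) := by
  change yonedaEquiv ((yonedaIsoProEmb C).hom ≫ (Ind.inclusion (FinAlg V)ᵒᵖ).map k.unop ≫ 𝟙 _) = _
  rw [Category.comp_id]

theorem proElem_comp {P Q : ProCat (FinAlg V)} {C : FinAlg V} (f : P ⟶ Q)
    (k : Q ⟶ (proEmb (FinAlg V)).obj C) :
    proElem P C (f ≫ k) =
      ((Ind.inclusion (FinAlg V)ᵒᵖ).map f.unop).app _ (proElem Q C k) := by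
  rw [proElem_eq, proElem_eq, unop_comp, Functor.map_comp, ← Category.assoc, yonedaEquiv_comp]

theorem proElem_map {P : ProCat (FinAlg V)} {C D : FinAlg V} (k : P ⟶ (proEmb (FinAlg V)).obj C)
    (f : C ⟶ D) : proElem P D (k ≫ (proEmb (FinAlg V)).map f) =
      ((Ind.inclusion (FinAlg V)ᵒᵖ).obj P.unop).map f.op.op (proElem P C k) := by
  rw [proElem_eq, proElem_eq, yonedaEquiv_naturality, unop_comp, Functor.map_comp,
    ← Category.assoc, ← Category.assoc, yonedaIsoProEmb_naturality]

theorem map_comp_point {P : ProCat (FinAlg V)} {C : FinAlg V} (k : P ⟶ (proEmb (FinAlg V)).obj C)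
    (p : ProPoint P) : (Ind.inclusion (FinAlg V)ᵒᵖ).map k.unop ≫ p =
      elemEquivPoint C (p.app (op (op C)) (proElem P C k)) := by
  rw [proElem_eq, ← yonedaEquiv_comp]
  change _ = (yonedaIsoProEmb C).inv ≫ yonedaEquiv.symm (yonedaEquiv _) ≫ 𝟙 _
  rw [Equiv.symm_apply_apply, Category.comp_id, Category.assoc, Iso.inv_hom_id_assoc]

/-- The element of a finite algebra at which a map to it sends a point. -/
theorem proIncl_map_equivShrink {P : ProCat (FinAlg V)} {C : FinAlg V}
    (k : P ⟶ (proEmb (FinAlg V)).obj C) (p : ProPoint P) :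
    (proIncl V).map k (equivShrink (ProPoint P) p) =
      (elemIso C).hom (p.app (op (op C)) (proElem P C k)) := by
  refine (proForget_map_equivShrink k p).trans ?_
  rw [map_comp_point]
  rfl

end Elements

/-! ### The free pro-object as a limit of finite models -/

section FreeLimit

variable {V : ObjectProperty ModAlg.{u}} (hV : IsVariety V) (X : Type u)

/-- The assignment of the generators given by a finite model of the free algebra. -/
def modelValues (m : StructuredArrow (freeAlg V X) (finiteMembers V).ι) : X → m.right.obj :=
  fun x => m.hom (freeUnit V X x)

theorem exists_model (C : FinAlg V) (v : X → C.obj) :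
    ∃ h : freeAlg V X ⟶ C.obj, ∀ x, h (freeUnit V X x) = v x := by
  obtain ⟨h, hh, -⟩ := freeAlg_universal X C.obj C.property.1 v
  exact ⟨⟨h⟩, hh⟩

theorem model_hom_ext {C : FinAlg V} {h k : freeAlg V X ⟶ C.obj}
    (H : ∀ x, h (freeUnit V X x) = k (freeUnit V X x)) : h = k :=
  ModAlg.Hom.ext ((freeAlg_universal X C.obj C.property.1
    (fun x => k (freeUnit V X x))).unique H fun _ => rfl)

/-- The element of the presheaf of the free pro-object given by a finite model. -/
noncomputable def modelElem (m : StructuredArrow (freeAlg V X) (finiteMembers V).ι) :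
    ((Ind.inclusion (FinAlg V)ᵒᵖ).obj (freePro hV X).unop).obj (op (op m.right)) :=
  (freeProIso hV X).inv.app _ (modelValues X m)

theorem map_modelElem {m n : StructuredArrow (freeAlg V X) (finiteMembers V).ι} (f : m ⟶ n) :
    ((Ind.inclusion (FinAlg V)ᵒᵖ).obj (freePro hV X).unop).map f.right.op.op (modelElem hV X m) =
      modelElem hV X n := by
  refine (NatTrans.naturality_apply (freeProIso hV X).inv f.right.op.op
    (modelValues X m)).symm.trans (congrArg _ (funext fun x => ?_))
  rw [modelValues, ← StructuredArrow.w f]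
  rfl

theorem freePoint_modelElem (m : StructuredArrow (freeAlg V X) (finiteMembers V).ι) (x : X) :
    (freePoint hV X x).app _ (modelElem hV X m) = m.hom (freeUnit V X x) := by
  have h : ∀ v, (freeProIso hV X).hom.app (op (op m.right))
      ((freeProIso hV X).inv.app (op (op m.right)) v) = v := fun v =>
    congrArg (fun t => t.app (op (op m.right)) v) (freeProIso hV X).inv_hom_id
  exact congrFun (h (modelValues X m)) x

/-- A map out of the presheaf of the free pro-object is determined by its values at the elements given
by finite models. -/
theorem freePro_hom_ext {G : (FinAlg V)ᵒᵖᵒᵖ ⥤ Type u}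
    {s t : (Ind.inclusion (FinAlg V)ᵒᵖ).obj (freePro hV X).unop ⟶ G}
    (h : ∀ m, s.app _ (modelElem hV X m) = t.app _ (modelElem hV X m)) : s = t := by
  rw [← cancel_epi (freeProIso hV X).inv]
  ext C v
  obtain ⟨k, hk⟩ := exists_model X C.unop.unop v
  obtain rfl : modelValues X (StructuredArrow.mk (T := (finiteMembers V).ι) k) = v := funext hk
  exact h (StructuredArrow.mk (T := (finiteMembers V).ι) k)

/-- Compatible values at the elements given by finite models extend to a map out of the presheaf of
the free pro-object. -/
theorem exists_freePro_hom {G : (FinAlg V)ᵒᵖᵒᵖ ⥤ Type u}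
    (y : ∀ m : StructuredArrow (freeAlg V X) (finiteMembers V).ι, G.obj (op (op m.right)))
    (hy : ∀ {m n : StructuredArrow (freeAlg V X) (finiteMembers V).ι} (f : m ⟶ n),
      G.map f.right.op.op (y m) = y n) :
    ∃ t : (Ind.inclusion (FinAlg V)ᵒᵖ).obj (freePro hV X).unop ⟶ G,
      ∀ m, t.app _ (modelElem hV X m) = y m := by
  choose k hk using exists_model (V := V) X
  let μ : ∀ (C : FinAlg V) (_ : X → C.obj), StructuredArrow (freeAlg V X) (finiteMembers V).ι :=
    fun C v => StructuredArrow.mk (T := (finiteMembers V).ι) (k C v)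
  let t : powPresheaf V X ⟶ G :=
    { app := fun C => ↾fun v => y (μ C.unop.unop v)
      naturality := fun C D f => by
        ext v
        refine (hy (StructuredArrow.homMk f.unop.unop
          (model_hom_ext (C := D.unop.unop) X fun x => ?_) :
          μ C.unop.unop v ⟶ μ D.unop.unop ((powPresheaf V X).map f v))).symm
        refine Eq.trans ?_ (hk D.unop.unop ((powPresheaf V X).map f v) x).symm
        exact congrArg f.unop.unop.hom (hk C.unop.unop v x) }
  refine ⟨(freeProIso hV X).hom ≫ t, fun m => ?_⟩
  have h : (freeProIso hV X).hom.app (op (op m.right)) (modelElem hV X m) = modelValues X m :=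
    congrArg (fun t => t.app (op (op m.right)) (modelValues X m)) (freeProIso hV X).inv_hom_id
  refine (congrArg (t.app _) h).trans ?_
  change y (μ m.right (modelValues X m)) = y m
  -- `m` and the model chosen for its values agree on generators, so the identity of `m.right` is a
  -- morphism between them and compatibility applies.
  have := hy (StructuredArrow.homMk (𝟙 m.right) (model_hom_ext (C := m.right) X fun x => ?_) :
    μ m.right (modelValues X m) ⟶ m)
  · rw [← this]
    exact (Functor.map_id_apply G _ _).symm
  · exact hk m.right (modelValues X m) x

/-- The map from the free pro-object to a finite model of the free algebra. -/
noncomputable def freeProProj (m : StructuredArrow (freeAlg V X) (finiteMembers V).ι) :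
    freePro hV X ⟶ (proEmb (FinAlg V)).obj m.right :=
  (proElem (freePro hV X) m.right).symm (modelElem hV X m)

theorem proElem_freeProProj (m : StructuredArrow (freeAlg V X) (finiteMembers V).ι) :
    proElem (freePro hV X) m.right (freeProProj hV X m) = modelElem hV X m :=
  Equiv.apply_symm_apply _ _

theorem freeProProj_comp {m n : StructuredArrow (freeAlg V X) (finiteMembers V).ι} (f : m ⟶ n) :
    freeProProj hV X m ≫ (proEmb (FinAlg V)).map f.right = freeProProj hV X n := by
  apply (proElem (freePro hV X) n.right).injective
  rw [proElem_map, proElem_freeProProj, proElem_freeProProj, map_modelElem]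

/-- The cone exhibiting the free pro-object as the limit of the finite models of the free
algebra. -/
noncomputable def freeProCone : Cone (finModels V (freeAlg V X)) where
  pt := freePro hV X
  π :=
    { app := freeProProj hV X
      naturality := fun _ _ f => (Category.id_comp _).trans (freeProProj_comp hV X f).symm }

theorem nonempty_isLimit_freeProCone : Nonempty (IsLimit (freeProCone hV X)) := by
  have hlift : ∀ s : Cone (finModels V (freeAlg V X)), ∃ f : s.pt ⟶ freePro hV X,
      ∀ m, f ≫ (freeProCone hV X).π.app m = s.π.app m := by
    intro s
    let σ : ∀ m : StructuredArrow (freeAlg V X) (finiteMembers V).ι,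
      s.pt ⟶ (proEmb (FinAlg V)).obj m.right := s.π.app
    have hσ : ∀ {m n : StructuredArrow (freeAlg V X) (finiteMembers V).ι} (f : m ⟶ n),
        σ m ≫ (proEmb (FinAlg V)).map f.right = σ n := fun f => s.w f
    obtain ⟨t, ht⟩ := exists_freePro_hom hV X (fun m => proElem s.pt m.right (σ m))
      fun {m n} f => by rw [← proElem_map, hσ]
    refine ⟨((Ind.inclusion (FinAlg V)ᵒᵖ).preimage t).op, fun m => ?_⟩
    change _ ≫ freeProProj hV X m = σ m
    apply (proElem s.pt m.right).injective
    rw [proElem_comp, proElem_freeProProj, Quiver.Hom.unop_op, Functor.map_preimage, ht]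
  have huniq : ∀ {P : ProCat (FinAlg V)} (f g : P ⟶ freePro hV X),
      (∀ m, f ≫ freeProProj hV X m = g ≫ freeProProj hV X m) → f = g := by
    intro P f g h
    apply Quiver.Hom.unop_inj
    apply (Ind.inclusion (FinAlg V)ᵒᵖ).map_injective
    refine freePro_hom_ext hV X fun m => ?_
    rw [← proElem_freeProProj, ← proElem_comp, ← proElem_comp, h]
  choose l hl using hlift
  exact ⟨{
    lift := l
    fac := hl
    uniq := fun s f hf => huniq _ _ fun m => (hf m).trans (hl s m).symm }⟩

theorem elemIso_hom_injective (C : FinAlg V) : Function.Injective (elemIso C).hom :=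
  ((elemEquivPoint C).trans (equivShrink _)).injective

theorem elemIso_hom_surjective (C : FinAlg V) : Function.Surjective (elemIso C).hom :=
  ((elemEquivPoint C).trans (equivShrink _)).surjective

theorem proIncl_map_freeProCone (m : StructuredArrow (freeAlg V X) (finiteMembers V).ι)
    (p : ProPoint (freePro hV X)) :
    (proIncl V).map ((freeProCone hV X).π.app m) (equivShrink (ProPoint (freePro hV X)) p) =
      (elemIso m.right).hom (p.app (op (op m.right)) (modelElem hV X m)) :=
  (proIncl_map_equivShrink (freeProProj hV X m) p).trans (by rw [proElem_freeProProj])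

theorem proIncl_freeProCone_injective (x y : (proIncl V).obj (freePro hV X))
    (h : ∀ m, (proIncl V).map ((freeProCone hV X).π.app m) x =
      (proIncl V).map ((freeProCone hV X).π.app m) y) : x = y := by
  obtain ⟨x, rfl⟩ := (equivShrink (ProPoint (freePro hV X))).surjective x
  obtain ⟨y, rfl⟩ := (equivShrink (ProPoint (freePro hV X))).surjective y
  refine congrArg _ (freePro_hom_ext hV X fun m => elemIso_hom_injective m.right ?_)
  exact (proIncl_map_freeProCone hV X m x).symm.trans
    ((h m).trans (proIncl_map_freeProCone hV X m y))

theorem nonempty_isLimit_mapCone_freeProCone :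
    Nonempty (IsLimit ((proIncl V).mapCone (freeProCone hV X))) := by
  refine ModAlg.nonempty_isLimit _ (proIncl_freeProCone_injective hV X) fun s hs => ?_
  choose y hy using fun m : StructuredArrow (freeAlg V X) (finiteMembers V).ι =>
    elemIso_hom_surjective m.right (s m)
  -- Undoing `elemIso` turns a compatible family in the diagram into one in `finForget`, and such a
  -- family is a point.
  obtain ⟨t, ht⟩ := exists_freePro_hom hV X (G := finForget V) y fun {m n} f => by
    apply elemIso_hom_injective n.right
    refine Eq.trans ?_ ((hs f).trans (hy n).symm)
    rw [← hy m]
    exact congrArg (fun t => t (y m)) ((inclIso V).hom.naturality f.right)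
  refine ⟨equivShrink _ t, fun m => (proIncl_map_freeProCone hV X m t).trans ?_⟩
  rw [ht, hy]

/-- The limit projections are jointly injective, and at a model `m` both sides send `x` to the copy
of `m.hom (freeUnit V X x)`. -/
theorem unit_freeProAdj_comp (hι : IsLimit ((proIncl V).mapCone (freeProCone hV X))) :
    (freeProAdj hV).unit.app X =
      freeUnit V X ≫ (forget ModAlg.{u}).map (hι.lift (modelCone V (freeAlg V X))) := by
  have hunit : (freeProAdj hV).unit.app X = freeProHomEquiv hV X _ (𝟙 _) := by
    rw [← Adjunction.homEquiv_id]
    exact freeProAdj_homEquiv hV _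
  have hx : ∀ x, (freeProAdj hV).unit.app X x =
      equivShrink (ProPoint (freePro hV X)) (freePoint hV X x) := by
    intro x
    rw [hunit]
    refine (freeProHomEquiv_apply hV (𝟙 (freePro hV X)) x).trans ?_
    rw [unop_id, CategoryTheory.Functor.map_id, Category.id_comp]
  ext x
  refine (hx x).trans (proIncl_freeProCone_injective hV X _ _ fun m => ?_)
  refine (proIncl_map_freeProCone hV X m _).trans ?_
  rw [freePoint_modelElem]
  exact (congrArg (fun t => t (freeUnit V X x)) (hι.fac (modelCone V (freeAlg V X)) m)).symm

end FreeLimit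

theorem mainTheorem6 (V : ObjectProperty ModAlg.{u}) (hV : IsVariety V)
    (hfa : FinitelyApproximable V) :
    Nonempty (MonadicRightAdjoint (proForget V)) ∧
    ∀ (L : Type u ⥤ ProCat (FinAlg V)) (adj : L ⊣ proForget V) (X : Type u),
      ∃ (c : Cone (finModels V (freeAlg V X))) (_ : IsLimit c)
        (hι : IsLimit ((proIncl V).mapCone c)) (i : L.obj X ≅ c.pt),
        adj.unit.app X ≫ (proForget V).map i.hom =
          freeUnit V X ≫ (forget ModAlg.{u}).map (hι.lift (modelCone V (freeAlg V X))) := by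
  refine ⟨proForget_monadic hV, fun L adj X => ?_⟩
  obtain ⟨hc⟩ := nonempty_isLimit_freeProCone hV X
  obtain ⟨hι⟩ := nonempty_isLimit_mapCone_freeProCone hV X
  refine ⟨freeProCone hV X, hc, hι, (adj.leftAdjointUniq (freeProAdj hV)).app X, ?_⟩
  exact (Adjunction.unit_leftAdjointUniq_hom_app adj (freeProAdj hV) X).trans
    (unit_freeProAdj_comp hV X hι)
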